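/- A \emph{rooted geometric graph} $G=(P,E)$ consists of a finite set $P\subset\mathbb{R}^2$ of points (the vertices), a designated point $r\in P$ (the root), and a set $E$ of line segments joining pairs of distinct points of $P$. For a nonzero vector $d\in\mathbb{R}^2$, a path $(w_0,\dots,w_l)$ of $G$ is \emph{monotone in direction} $d$ if $\langle d,w_0\rangle\le\langle d,w_1\rangle\le\dots\le\langle d,w_l\rangle$ or $\langle d,w_0\rangle\ge\langle d,w_1\rangle\ge\dots\ge\langle d,w_l\rangle$. The graph $G$ is \emph{rooted uniform monotone} if there is a single direction $d\neq 0$ such that every vertex of $G$ is connected to the root by a path of $G$ that is monotone in direction $d$. \textbf{Theorem.} There is an algorithm which, given any rooted connected geometric graph $G=(P,E)$ in general position (no three points of $P$ are collinear), decides in $O(|E|\log|P|)$ time whether $G$ is rooted uniform monotone (for $|P|=1$, where $|E|\log|P|=0$, in $O(1)$ time). Here an algorithm is a single program for a real RAM, independent of $G$: its memory holds real numbers and machine words (natural numbers bounded by a fixed power of $|P|+1$, used as addresses and counters), the operations on reals are $+,-,\times,/$ and comparisons, those on words are $+$, $-$, $\times$, integer division and comparisons, there is no rounding of reals to words, and each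 elementary operation or memory access takes one step. The input consists of $|P|$, $|E|$, the index of $r$, the list of the coordinates of the points of $P$ in an arbitrary order, and the list of the edges, each once and in an arbitrary order, as pairs (in either order) of indices of points; all other memory initially has arbitrary contents. -/

import Mathlib

/-! ## Rooted geometric graphs in the Euclidean plane -/

/-- The Euclidean plane. -/
abbrev Plane : Type := EuclideanSpace ℝ (Fin 2)

/-- A rooted geometric graph `G = (P, E)`: a finite set `P` of points of the plane, a set `E` of
segments between distinct points of `P` (each given by its two endpoints, hence a simple graph on
`P`; segments may cross), and a designated vertex, the root. -/
structure RootedGeometricGraph where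
  verts : Finset Plane
  graph : SimpleGraph verts
  root : verts

namespace RootedGeometricGraph

/-- `|P|`. -/
def numVerts (G : RootedGeometricGraph) : ℕ := G.verts.card

/-- `|E|`. -/
noncomputable def numEdges (G : RootedGeometricGraph) : ℕ := G.graph.edgeSet.ncard

/-- No three points of `P` are collinear. -/
def InGeneralPosition (G : RootedGeometricGraph) : Prop :=
  ∀ a ∈ G.verts, ∀ b ∈ G.verts, ∀ c ∈ G.verts,
    a ≠ b → a ≠ c → b ≠ c → ¬ Collinear ℝ ({a, b, c} : Set Plane)

/-- The coordinates of the successive vertices of a walk with respect to an axis directed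
along `d` (up to the positive factor `‖d‖`, which is irrelevant for monotonicity). -/
noncomputable def coordsAlong (G : RootedGeometricGraph) (d : Plane) {u v : G.verts}
    (w : G.graph.Walk u v) : List ℝ :=
  w.support.map (fun p => inner ℝ d (p : Plane))

/-- The path is monotone in direction `d`: its coordinates along `d` never decrease, or
never increase. -/
def MonotoneAlong (G : RootedGeometricGraph) (d : Plane) {u v : G.verts}
    (w : G.graph.Walk u v) : Prop :=
  (G.coordsAlong d w).IsChain (· ≤ ·) ∨ (G.coordsAlong d w).IsChain (· ≥ ·)

/-- Rooted `d`-monotone: the root is connected to every vertex by a path that is monotone in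
direction `d`. -/
def RootedMonotoneAlong (G : RootedGeometricGraph) (d : Plane) : Prop :=
  ∀ p : G.verts, ∃ w : G.graph.Walk G.root p, w.IsPath ∧ G.MonotoneAlong d w

/-- Rooted uniform monotone: rooted monotone in some single direction. -/
def RootedUniformMonotone (G : RootedGeometricGraph) : Prop :=
  ∃ d : Plane, d ≠ 0 ∧ G.RootedMonotoneAlong d

end RootedGeometricGraph

/-! ## The real RAM

Programs of a random access machine whose memory consists of finitely many (those named in the
program) scalar variables and arrays, each holding either machine words (natural numbers) or
real numbers.  Words serve as addresses and counters.  The only operations on reals are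
`+`, `-`, `*`, `/` and comparisons; in particular there is no rounding and no conversion of a
real into a word.  Every elementary operation costs one step. -/

namespace RealRAM

/-- The contents of the memory. -/
structure State where
  ivar : ℕ → ℕ
  rvar : ℕ → ℝ
  iarr : ℕ → ℕ → ℕ
  rarr : ℕ → ℕ → ℝ

/-- Word expressions. -/
inductive IExp where
  | const (n : ℕ)
  | var (x : ℕ)
  | get (a : ℕ) (e : IExp)
  | add (e₁ e₂ : IExp)
  | sub (e₁ e₂ : IExp)
  | mul (e₁ e₂ : IExp)
  | div (e₁ e₂ : IExp)

/-- Real expressions. -/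
inductive RExp where
  | const (q : ℚ)
  | var (x : ℕ)
  | get (a : ℕ) (e : IExp)
  | add (e₁ e₂ : RExp)
  | sub (e₁ e₂ : RExp)
  | mul (e₁ e₂ : RExp)
  | div (e₁ e₂ : RExp)

/-- Tests. -/
inductive BExp where
  | ieq (e₁ e₂ : IExp)
  | ilt (e₁ e₂ : IExp)
  | req (e₁ e₂ : RExp)
  | rlt (e₁ e₂ : RExp)
  | not (b : BExp)
  | and (b₁ b₂ : BExp)
  | or (b₁ b₂ : BExp)

/-- Value of a word expression (subtraction is truncated at zero, division rounds down). -/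
def IExp.eval (s : State) : IExp → ℕ
  | const n => n
  | var x => s.ivar x
  | get a e => s.iarr a (e.eval s)
  | add e₁ e₂ => e₁.eval s + e₂.eval s
  | sub e₁ e₂ => e₁.eval s - e₂.eval s
  | mul e₁ e₂ => e₁.eval s * e₂.eval s
  | div e₁ e₂ => e₁.eval s / e₂.eval s

/-- Value of a real expression (a quotient by zero has value zero; a program can test for it). -/
noncomputable def RExp.eval (s : State) : RExp → ℝ
  | const q => (q : ℝ)
  | var x => s.rvar x
  | get a e => s.rarr a (e.eval s)
  | add e₁ e₂ => e₁.eval s + e₂.eval s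
  | sub e₁ e₂ => e₁.eval s - e₂.eval s
  | mul e₁ e₂ => e₁.eval s * e₂.eval s
  | div e₁ e₂ => e₁.eval s / e₂.eval s

/-- Truth of a test. -/
def BExp.Holds (s : State) : BExp → Prop
  | ieq e₁ e₂ => e₁.eval s = e₂.eval s
  | ilt e₁ e₂ => e₁.eval s < e₂.eval s
  | req e₁ e₂ => e₁.eval s = e₂.eval s
  | rlt e₁ e₂ => e₁.eval s < e₂.eval s
  | not b => ¬ b.Holds s
  | and b₁ b₂ => b₁.Holds s ∧ b₂.Holds s
  | or b₁ b₂ => b₁.Holds s ∨ b₂.Holds s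

/-- Number of elementary operations needed to evaluate a word expression. -/
def IExp.cost : IExp → ℕ
  | const _ => 1
  | var _ => 1
  | get _ e => e.cost + 1
  | add e₁ e₂ => e₁.cost + e₂.cost + 1
  | sub e₁ e₂ => e₁.cost + e₂.cost + 1
  | mul e₁ e₂ => e₁.cost + e₂.cost + 1
  | div e₁ e₂ => e₁.cost + e₂.cost + 1

/-- Number of elementary operations needed to evaluate a real expression. -/
def RExp.cost : RExp → ℕ
  | const _ => 1
  | var _ => 1
  | get _ e => e.cost + 1
  | add e₁ e₂ => e₁.cost + e₂.cost + 1
  | sub e₁ e₂ => e₁.cost + e₂.cost + 1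
  | mul e₁ e₂ => e₁.cost + e₂.cost + 1
  | div e₁ e₂ => e₁.cost + e₂.cost + 1

/-- Number of elementary operations needed to evaluate a test. -/
def BExp.cost : BExp → ℕ
  | ieq e₁ e₂ => e₁.cost + e₂.cost + 1
  | ilt e₁ e₂ => e₁.cost + e₂.cost + 1
  | req e₁ e₂ => e₁.cost + e₂.cost + 1
  | rlt e₁ e₂ => e₁.cost + e₂.cost + 1
  | not b => b.cost + 1
  | and b₁ b₂ => b₁.cost + b₂.cost + 1
  | or b₁ b₂ => b₁.cost + b₂.cost + 1

/-- Programs. -/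
inductive Prog where
  | skip
  | setI (x : ℕ) (e : IExp)
  | setR (x : ℕ) (e : RExp)
  | storeI (a : ℕ) (i : IExp) (e : IExp)
  | storeR (a : ℕ) (i : IExp) (e : RExp)
  | seq (p q : Prog)
  | ite (b : BExp) (p q : Prog)
  | loop (b : BExp) (p : Prog)

def State.setI (s : State) (x v : ℕ) : State :=
  { s with ivar := Function.update s.ivar x v }

def State.setR (s : State) (x : ℕ) (v : ℝ) : State :=
  { s with rvar := Function.update s.rvar x v }

def State.storeI (s : State) (a i v : ℕ) : State :=
  { s with iarr := Function.update s.iarr a (Function.update (s.iarr a) i v) }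

def State.storeR (s : State) (a i : ℕ) (v : ℝ) : State :=
  { s with rarr := Function.update s.rarr a (Function.update (s.rarr a) i v) }

/-- `Exec W p s t s'`: started in state `s`, the program `p` halts after exactly `t` steps in
state `s'`, where no word greater than `W` is ever written and no memory cell with an address
greater than `W` is ever written (the machine gets stuck otherwise). `loop b p` is the while
loop. -/
inductive Exec (W : ℕ) : Prog → State → ℕ → State → Prop where
  | skip (s : State) : Exec W Prog.skip s 1 s
  | setI (x : ℕ) (e : IExp) (s : State) (h : e.eval s ≤ W) :
      Exec W (Prog.setI x e) s (e.cost + 1) (s.setI x (e.eval s))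
  | setR (x : ℕ) (e : RExp) (s : State) :
      Exec W (Prog.setR x e) s (e.cost + 1) (s.setR x (e.eval s))
  | storeI (a : ℕ) (i e : IExp) (s : State) (hi : i.eval s ≤ W) (h : e.eval s ≤ W) :
      Exec W (Prog.storeI a i e) s (i.cost + e.cost + 1) (s.storeI a (i.eval s) (e.eval s))
  | storeR (a : ℕ) (i : IExp) (e : RExp) (s : State) (hi : i.eval s ≤ W) :
      Exec W (Prog.storeR a i e) s (i.cost + e.cost + 1) (s.storeR a (i.eval s) (e.eval s))
  | seq {p q : Prog} {s s' s'' : State} {t t' : ℕ}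
      (hp : Exec W p s t s') (hq : Exec W q s' t' s'') :
      Exec W (Prog.seq p q) s (t + t') s''
  | iteTrue {b : BExp} {p q : Prog} {s s' : State} {t : ℕ}
      (hb : b.Holds s) (hp : Exec W p s t s') :
      Exec W (Prog.ite b p q) s (b.cost + t) s'
  | iteFalse {b : BExp} {p q : Prog} {s s' : State} {t : ℕ}
      (hb : ¬ b.Holds s) (hq : Exec W q s t s') :
      Exec W (Prog.ite b p q) s (b.cost + t) s'
  | loopStop {b : BExp} {p : Prog} {s : State}
      (hb : ¬ b.Holds s) :
      Exec W (Prog.loop b p) s b.cost s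
  | loopStep {b : BExp} {p : Prog} {s s' s'' : State} {t t' : ℕ}
      (hb : b.Holds s) (hp : Exec W p s t s') (hl : Exec W (Prog.loop b p) s' t' s'') :
      Exec W (Prog.loop b p) s (b.cost + t + t') s''

/-- The state `s` holds the rooted geometric graph `G` as an input: word variables `0`, `1`, `2`
hold `|P|`, `|E|` and the index of the root; real arrays `0` and `1` hold the `x`- and
`y`-coordinates of the points, listed in some order; word arrays `0` and `1` hold the indices
of the two endpoints of the edges, listed in some order without repetition. All other memory
cells have arbitrary contents. -/
def Encodes (s : State) (G : RootedGeometricGraph) : Prop :=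
  ∃ (pt : Fin G.numVerts ≃ G.verts) (ed : Fin G.numEdges ≃ G.graph.edgeSet),
    s.ivar 0 = G.numVerts ∧ s.ivar 1 = G.numEdges ∧
    s.ivar 2 = (pt.symm G.root : ℕ) ∧
    (∀ i : Fin G.numVerts, s.rarr 0 i = (pt i : Plane) 0 ∧ s.rarr 1 i = (pt i : Plane) 1) ∧
    (∀ j : Fin G.numEdges, ∃ u v : Fin G.numVerts,
      s.iarr 0 j = u ∧ s.iarr 1 j = v ∧ s(pt u, pt v) = (ed j : Sym2 G.verts))

end RealRAM

namespace RealRAM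

/-! ### Total correctness with time bounds -/

/-! Fix a direction `d` and measure heights along `d` from the root. A neighbour `u` supports `v` if
its height lies weakly between 0 and the height of `v`. Along a monotone path from the root the
heights never move back towards 0, so monotone reachability is reachability through supporters
(`rootedMonotoneAlong_iff_reflTransGen`). In general position a line orthogonal to `d` carries at
most two vertices, and the condition becomes local: every vertex but the root has a supporter, and
no two adjacent tied vertices other than the root are supported by each other only
(`rootedMonotoneAlong_iff_local`).

Finitely many directions suffice. If `d` is orthogonal to no edge, it can be turned until some edge
becomes orthogonal, and no edge is reversed on the way (`rootedUniformMonotone_iff_exists_adj`);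
directions orthogonal to the same edge are parallel. A small shear makes no edge horizontal, so
every candidate is, up to a factor, a direction `sweepDir δ t`, along which the heights are `X + t *
Y`. For an arc away from the root, the support condition is the sign of a quadratic in `t` whose
roots are two tie times; hence it holds on an interval or off an open interval. `weight` writes this
as an initial value plus one activation minus one deactivation. Adding weights over the arcs into a
vertex gives its counter, and the problem becomes a test of the counters at the tie time of each
arc: all are positive, and no tied arc has counter one at both ends
(`Coords.rootedUniformMonotone_iff`).

The program sweeps `t` through four events per arc: activation, mark, check, deactivation. They are
sorted by time and, at equal times, in this order of kinds, so that at marks and checks the counters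
have exactly the values that the criterion needs (`curCount_eq_count`). Each event takes constant
time; `SweepInv` and its lemmas `activate`, `mark`, `check`, `deactivate` carry correctness. The
sort is a tournament tree with logarithmic cost per extraction. The number of events is at most four
times the square of the number of vertices, so this logarithm is `O(log |P|)`, and connectedness
lets the edges pay for the passes over the vertices. -/

/-- Started in `s`, the program `p` halts within `T` steps in a state satisfying `Q`. -/
def Runs (W : ℕ) (p : Prog) (s : State) (T : ℕ) (Q : State → Prop) : Prop :=
  ∃ t s', Exec W p s t s' ∧ t ≤ T ∧ Q s'

theorem Runs.mono {W : ℕ} {p : Prog} {s : State} {T T' : ℕ} {Q Q' : State → Prop}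
    (h : Runs W p s T Q) (hT : T ≤ T') (hQ : ∀ s', Q s' → Q' s') : Runs W p s T' Q' := by
  obtain ⟨t, s', he, ht, hq⟩ := h
  exact ⟨t, s', he, ht.trans hT, hQ _ hq⟩

theorem Runs.seq {W : ℕ} {p q : Prog} {s : State} {T T' : ℕ} {Q Q' : State → Prop}
    (hp : Runs W p s T Q) (hq : ∀ s', Q s' → Runs W q s' T' Q') :
    Runs W (Prog.seq p q) s (T + T') Q' := by
  obtain ⟨t, s', he, ht, hs'⟩ := hp
  obtain ⟨t', s'', he', ht', hs''⟩ := hq s' hs'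
  exact ⟨t + t', s'', Exec.seq he he', Nat.add_le_add ht ht', hs''⟩

/-- The index of the invariant is a potential that drops by one in each round and so bounds the
number of rounds. This form serves loops whose exact number of rounds is not known. -/
theorem Runs.loop_fuel {W : ℕ} {b : BExp} {p : Prog} {c : ℕ} (I : ℕ → State → Prop)
    (hp : ∀ j s, I j s → b.Holds s → ∃ j', j = j' + 1 ∧ Runs W p s c (I j')) :
    ∀ j s, I j s →
      Runs W (Prog.loop b p) s (j * (b.cost + c) + b.cost) (fun s => (∃ j, I j s) ∧ ¬ b.Holds s) := by
  intro j
  induction j with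
  | zero =>
    intro s hI
    by_cases hb : b.Holds s
    · obtain ⟨j', hj, -⟩ := hp 0 s hI hb
      omega
    · exact ⟨_, s, Exec.loopStop hb, by simp, ⟨0, hI⟩, hb⟩
  | succ j ih =>
    intro s hI
    by_cases hb : b.Holds s
    · obtain ⟨j', hj, t, s', he, ht, hI'⟩ := hp _ s hI hb
      obtain rfl : j = j' := by omega
      obtain ⟨t', s'', he', ht', hQ⟩ := ih s' hI'
      refine ⟨_, s'', Exec.loopStep hb he he', ?_, hQ⟩
      rw [Nat.succ_mul]
      omega
    · exact ⟨_, s, Exec.loopStop hb, by omega, ⟨_, hI⟩, hb⟩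

/-- The rule for counting loops: the fuel of `Runs.loop_fuel` is the number of rounds still to come.
-/
theorem Runs.loop_up {W : ℕ} {b : BExp} {p : Prog} {s : State} {N c : ℕ} (I : ℕ → State → Prop)
    (h0 : I 0 s) (hb : ∀ k s, k ≤ N → I k s → (b.Holds s ↔ k < N))
    (hp : ∀ k s, k < N → I k s → Runs W p s c (I (k + 1))) :
    Runs W (Prog.loop b p) s (N * (b.cost + c) + b.cost) (I N) := by
  refine (Runs.loop_fuel (fun j s => j ≤ N ∧ I (N - j) s) ?_ N s ⟨le_rfl, by simpa using h0⟩).mono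
    le_rfl ?_
  · rintro j s ⟨hj, hI⟩ hh
    have hlt := (hb _ s (Nat.sub_le _ _) hI).1 hh
    obtain ⟨j', rfl⟩ : ∃ j', j = j' + 1 := ⟨j - 1, by omega⟩
    refine ⟨j', rfl, (hp _ s hlt hI).mono le_rfl fun s' h => ⟨by omega, ?_⟩⟩
    rwa [show N - j' = N - (j' + 1) + 1 by omega]
  · rintro s' ⟨⟨j, hj, hI⟩, hn⟩
    have := (hb _ s' (Nat.sub_le _ _) hI).not.1 hn
    obtain rfl : j = 0 := by omega
    simpa using hI

/-- An upper bound for the running time of a program without loops. -/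
def Prog.bound : Prog → ℕ
  | skip => 1
  | setI _ e => e.cost + 1
  | setR _ e => e.cost + 1
  | storeI _ i e => i.cost + e.cost + 1
  | storeR _ i e => i.cost + e.cost + 1
  | seq p q => p.bound + q.bound
  | ite b p q => b.cost + (p.bound + q.bound)
  | loop _ _ => 0

/-- The weakest precondition of a program without loops. -/
def Prog.wp (W : ℕ) : Prog → (State → Prop) → State → Prop
  | skip, Q, s => Q s
  | setI x e, Q, s => e.eval s ≤ W ∧ Q (s.setI x (e.eval s))
  | setR x e, Q, s => Q (s.setR x (e.eval s))
  | storeI a i e, Q, s =>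
      (i.eval s ≤ W ∧ e.eval s ≤ W) ∧ Q (s.storeI a (i.eval s) (e.eval s))
  | storeR a i e, Q, s => i.eval s ≤ W ∧ Q (s.storeR a (i.eval s) (e.eval s))
  | seq p q, Q, s => p.wp W (q.wp W Q) s
  | ite b p q, Q, s => (b.Holds s → p.wp W Q s) ∧ (¬ b.Holds s → q.wp W Q s)
  | loop _ _, _, _ => False

/-- Reduces loop-free code to a condition that `simp` can unfold. The bound 0 for loops is harmless
because their precondition is `False`; for a conditional the bounds of both branches are added. -/
theorem Prog.wp.runs {W : ℕ} : ∀ {p : Prog} {Q : State → Prop} {s : State},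
    p.wp W Q s → Runs W p s p.bound Q
  | .skip, Q, s, h => ⟨_, s, Exec.skip s, le_rfl, h⟩
  | .setI x e, Q, s, h => ⟨_, _, Exec.setI x e s h.1, le_rfl, h.2⟩
  | .setR x e, Q, s, h => ⟨_, _, Exec.setR x e s, le_rfl, h⟩
  | .storeI a i e, Q, s, h => ⟨_, _, Exec.storeI a i e s h.1.1 h.1.2, le_rfl, h.2⟩
  | .storeR a i e, Q, s, h => ⟨_, _, Exec.storeR a i e s h.1, le_rfl, h.2⟩
  | .seq p q, Q, s, h => Runs.seq (Prog.wp.runs (p := p) h) fun _ h' => Prog.wp.runs (p := q) h'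
  | .ite b p q, Q, s, h => by
    by_cases hb : b.Holds s
    · obtain ⟨t, s', he, ht, hQ⟩ := Prog.wp.runs (p := p) (h.1 hb)
      exact ⟨_, s', Exec.iteTrue hb he, by simp only [Prog.bound]; omega, hQ⟩
    · obtain ⟨t, s', he, ht, hQ⟩ := Prog.wp.runs (p := q) (h.2 hb)
      exact ⟨_, s', Exec.iteFalse hb he, by simp only [Prog.bound]; omega, hQ⟩

/-! ### Memory that a program does not write -/

/-- The program may write the word variable `x`. -/
def Prog.WritesI (x : ℕ) : Prog → Prop
  | setI y _ => x = y
  | seq p q => p.WritesI x ∨ q.WritesI x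
  | ite _ p q => p.WritesI x ∨ q.WritesI x
  | loop _ p => p.WritesI x
  | _ => False

/-- The program may write the real variable `x`. -/
def Prog.WritesR (x : ℕ) : Prog → Prop
  | setR y _ => x = y
  | seq p q => p.WritesR x ∨ q.WritesR x
  | ite _ p q => p.WritesR x ∨ q.WritesR x
  | loop _ p => p.WritesR x
  | _ => False

/-- The program may write the word array `a`. -/
def Prog.StoresI (a : ℕ) : Prog → Prop
  | storeI y _ _ => a = y
  | seq p q => p.StoresI a ∨ q.StoresI a
  | ite _ p q => p.StoresI a ∨ q.StoresI a
  | loop _ p => p.StoresI a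
  | _ => False

/-- The program may write the real array `a`. -/
def Prog.StoresR (a : ℕ) : Prog → Prop
  | storeR y _ _ => a = y
  | seq p q => p.StoresR a ∨ q.StoresR a
  | ite _ p q => p.StoresR a ∨ q.StoresR a
  | loop _ p => p.StoresR a
  | _ => False

/-- The states agree on the memory that `p` does not write. -/
structure Frame (p : Prog) (s s' : State) : Prop where
  ivar : ∀ x, ¬ p.WritesI x → s'.ivar x = s.ivar x
  rvar : ∀ x, ¬ p.WritesR x → s'.rvar x = s.rvar x
  iarr : ∀ a, ¬ p.StoresI a → s'.iarr a = s.iarr a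
  rarr : ∀ a, ¬ p.StoresR a → s'.rarr a = s.rarr a

/-- With this, the specification of a phase needs to mention only what the phase computes; all other
memory is carried over by a syntactic check. -/
theorem Exec.frame {W : ℕ} {p : Prog} {s s' : State} {t : ℕ} (h : Exec W p s t s') :
    Frame p s s' := by
  induction h with
  | skip => exact ⟨fun _ _ => rfl, fun _ _ => rfl, fun _ _ => rfl, fun _ _ => rfl⟩
  | setI x e s h =>
    exact ⟨fun y hy => Function.update_of_ne hy _ _, fun _ _ => rfl, fun _ _ => rfl, fun _ _ => rfl⟩
  | setR x e s =>
    exact ⟨fun _ _ => rfl, fun y hy => Function.update_of_ne hy _ _, fun _ _ => rfl, fun _ _ => rfl⟩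
  | storeI x i e s =>
    exact ⟨fun _ _ => rfl, fun _ _ => rfl, fun y hy => Function.update_of_ne hy _ _, fun _ _ => rfl⟩
  | storeR x i e s =>
    exact ⟨fun _ _ => rfl, fun _ _ => rfl, fun _ _ => rfl, fun y hy => Function.update_of_ne hy _ _⟩
  | seq hp hq ihp ihq =>
    exact ⟨fun x hx => (ihq.ivar x fun h => hx (.inr h)).trans (ihp.ivar x fun h => hx (.inl h)),
      fun x hx => (ihq.rvar x fun h => hx (.inr h)).trans (ihp.rvar x fun h => hx (.inl h)),
      fun x hx => (ihq.iarr x fun h => hx (.inr h)).trans (ihp.iarr x fun h => hx (.inl h)),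
      fun x hx => (ihq.rarr x fun h => hx (.inr h)).trans (ihp.rarr x fun h => hx (.inl h))⟩
  | iteTrue hb hp ih =>
    exact ⟨fun x hx => ih.ivar x fun h => hx (.inl h), fun x hx => ih.rvar x fun h => hx (.inl h),
      fun x hx => ih.iarr x fun h => hx (.inl h), fun x hx => ih.rarr x fun h => hx (.inl h)⟩
  | iteFalse hb hp ih =>
    exact ⟨fun x hx => ih.ivar x fun h => hx (.inr h), fun x hx => ih.rvar x fun h => hx (.inr h),
      fun x hx => ih.iarr x fun h => hx (.inr h), fun x hx => ih.rarr x fun h => hx (.inr h)⟩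
  | loopStop => exact ⟨fun _ _ => rfl, fun _ _ => rfl, fun _ _ => rfl, fun _ _ => rfl⟩
  | loopStep hb hp hl ihp ihl =>
    exact ⟨fun x hx => (ihl.ivar x hx).trans (ihp.ivar x hx),
      fun x hx => (ihl.rvar x hx).trans (ihp.rvar x hx),
      fun x hx => (ihl.iarr x hx).trans (ihp.iarr x hx),
      fun x hx => (ihl.rarr x hx).trans (ihp.rarr x hx)⟩

theorem Runs.frame {W : ℕ} {p : Prog} {s : State} {T : ℕ} {Q : State → Prop}
    (h : Runs W p s T Q) : Runs W p s T (fun s' => Q s' ∧ Frame p s s') := by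
  obtain ⟨t, s', he, ht, hq⟩ := h
  exact ⟨t, s', he, ht, hq, he.frame⟩

end RealRAM

/-! ### Monotone paths and supporting neighbours -/

namespace RootedGeometricGraph

variable {G : RootedGeometricGraph} {d : Plane}

/-- The coordinate of a vertex along `d`, relative to the root. -/
noncomputable def height (G : RootedGeometricGraph) (d : Plane) (v : G.verts) : ℝ :=
  inner ℝ d (v : Plane) - inner ℝ d (G.root : Plane)

/-- The vertex `u` is adjacent to `v` and lies (weakly) between the root and `v` along `d`. -/
def Supports (G : RootedGeometricGraph) (d : Plane) (u v : G.verts) : Prop :=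
  G.graph.Adj u v ∧ 0 ≤ G.height d u * (G.height d v - G.height d u)

@[simp]
theorem height_root : G.height d G.root = 0 := sub_self _

theorem inner_eq (d p : Plane) : inner ℝ d p = d 0 * p 0 + d 1 * p 1 := by
  simp [PiLp.inner_apply, Fin.sum_univ_two, mul_comm]

theorem sq_add_sq_pos_of_ne_zero (hd : d ≠ 0) : 0 < d 0 ^ 2 + d 1 ^ 2 := by
  have h : 0 < ‖d‖ ^ 2 := by positivity
  rwa [EuclideanSpace.real_norm_sq_eq, Fin.sum_univ_two] at h

theorem coordsAlong_eq_map {u v : G.verts} (w : G.graph.Walk u v) :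
    G.coordsAlong d w = w.support.map (fun p : G.verts => inner ℝ d (p : Plane)) := by
  simp [coordsAlong]

theorem isChain_coordsAlong_cons {R : ℝ → ℝ → Prop} {u x v : G.verts} (hux : G.graph.Adj u x)
    (w : G.graph.Walk x v) : (G.coordsAlong d (.cons hux w)).IsChain R ↔
      R (inner ℝ d (u : Plane)) (inner ℝ d (x : Plane)) ∧ (G.coordsAlong d w).IsChain R := by
  rw [coordsAlong_eq_map, coordsAlong_eq_map, SimpleGraph.Walk.support_cons,
    ← SimpleGraph.Walk.cons_tail_support w]
  simp only [List.map_cons, List.isChain_cons_cons]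

/-- Heights that start nonnegative and never decrease stay nonnegative, so each vertex of the walk
supports the next one. -/
theorem reflTransGen_of_isChain_le {u v : G.verts} (w : G.graph.Walk u v) (hu : 0 ≤ G.height d u)
    (hw : (G.coordsAlong d w).IsChain (· ≤ ·)) : Relation.ReflTransGen (G.Supports d) u v := by
  induction w with
  | nil => exact .refl
  | @cons u x v hux w ih =>
    rw [isChain_coordsAlong_cons] at hw
    have h1 : G.height d u ≤ G.height d x := sub_le_sub_right hw.1 _
    exact .head ⟨hux, mul_nonneg hu (sub_nonneg.2 h1)⟩ (ih (hu.trans h1) hw.2)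

theorem reflTransGen_of_isChain_ge {u v : G.verts} (w : G.graph.Walk u v) (hu : G.height d u ≤ 0)
    (hw : (G.coordsAlong d w).IsChain (· ≥ ·)) : Relation.ReflTransGen (G.Supports d) u v := by
  induction w with
  | nil => exact .refl
  | @cons u x v hux w ih =>
    rw [isChain_coordsAlong_cons] at hw
    have h1 : G.height d x ≤ G.height d u := sub_le_sub_right hw.1 _
    exact .head ⟨hux, mul_nonneg_of_nonpos_of_nonpos hu (sub_nonpos.2 h1)⟩ (ih (h1.trans hu) hw.2)

theorem isChain_coordsAlong_concat {R : ℝ → ℝ → Prop} {u v x : G.verts} (w : G.graph.Walk u v)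
    (hvx : G.graph.Adj v x) (hw : (G.coordsAlong d w).IsChain R)
    (h : R (inner ℝ d (v : Plane)) (inner ℝ d (x : Plane))) :
    (G.coordsAlong d (w.concat hvx)).IsChain R := by
  rw [coordsAlong_eq_map, SimpleGraph.Walk.support_concat, List.map_append,
    List.isChain_append]
  refine ⟨by rwa [← coordsAlong_eq_map], by simp, ?_⟩
  intro a ha b hb
  simp only [List.map_cons, List.map_nil, List.head?_cons, Option.mem_def, Option.some.injEq] at hb
  rw [List.getLast?_map, List.getLast?_eq_some_getLast w.support_ne_nil,
    SimpleGraph.Walk.getLast_support] at ha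
  simp only [Option.map_some, Option.mem_def, Option.some.injEq] at ha
  rwa [← ha, ← hb]

/-- A vertex at height zero may be followed by one on either side of the root, so the induction
needs a single walk that serves both signs. -/
theorem exists_walk_of_reflTransGen {v : G.verts}
    (h : Relation.ReflTransGen (G.Supports d) G.root v) :
    ∃ w : G.graph.Walk G.root v,
      (0 ≤ G.height d v → (G.coordsAlong d w).IsChain (· ≤ ·)) ∧
      (G.height d v ≤ 0 → (G.coordsAlong d w).IsChain (· ≥ ·)) := by
  induction h with
  | refl => exact ⟨.nil, by simp [coordsAlong], by simp [coordsAlong]⟩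
  | @tail u v hu huv ih =>
    obtain ⟨w, h1, h2⟩ := ih
    obtain ⟨hadj, hs⟩ := huv
    refine ⟨w.concat hadj, fun hv => ?_, fun hv => ?_⟩
    · have : 0 ≤ G.height d u ∧ G.height d u ≤ G.height d v := by
        constructor <;> by_contra! hc <;> nlinarith
      exact isChain_coordsAlong_concat w hadj (h1 this.1)
        ((sub_le_sub_iff_right (inner ℝ d (G.root : Plane))).1 this.2)
    · have : G.height d u ≤ 0 ∧ G.height d v ≤ G.height d u := by
        constructor <;> by_contra! hc <;> nlinarith
      exact isChain_coordsAlong_concat w hadj (h2 this.1)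
        ((sub_le_sub_iff_right (inner ℝ d (G.root : Plane))).1 this.2)

theorem rootedMonotoneAlong_iff_reflTransGen :
    G.RootedMonotoneAlong d ↔ ∀ v, Relation.ReflTransGen (G.Supports d) G.root v := by
  classical
  constructor
  · intro h v
    obtain ⟨w, -, hw | hw⟩ := h v
    · exact reflTransGen_of_isChain_le w height_root.ge hw
    · exact reflTransGen_of_isChain_ge w height_root.le hw
  · intro h v
    obtain ⟨w, h1, h2⟩ := exists_walk_of_reflTransGen (h v)
    -- Cutting a walk down to a path leaves a sublist of its vertices, and chains of a transitive
    -- relation pass to sublists.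
    refine ⟨w.bypass, w.bypass_isPath, ?_⟩
    have hsub := w.support_bypass_sublist_support.map (fun p : G.verts => inner ℝ d (p : Plane))
    rw [← coordsAlong_eq_map, ← coordsAlong_eq_map] at hsub
    rcases le_total 0 (G.height d v) with hv | hv
    · exact .inl ((h1 hv).sublist hsub)
    · exact .inr ((h2 hv).sublist hsub)

/-- The condition is homogeneous quadratic in the heights, so scaling multiplies it by `c ^ 2`; the
sign of `c` does not matter. -/
theorem Supports.congr {d' : Plane} {c : ℝ} (hc : ∀ v, G.height d' v = c * G.height d v)
    {u v : G.verts} (h : G.Supports d u v) : G.Supports d' u v := by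
  refine ⟨h.1, ?_⟩
  rw [hc, hc, show c * G.height d u * (c * G.height d v - c * G.height d u)
    = c ^ 2 * (G.height d u * (G.height d v - G.height d u)) by ring]
  exact mul_nonneg (sq_nonneg c) h.2

theorem RootedMonotoneAlong.of_height_eq_mul {d' : Plane} {c : ℝ}
    (hc : ∀ v, G.height d' v = c * G.height d v) (h : G.RootedMonotoneAlong d) :
    G.RootedMonotoneAlong d' := by
  rw [rootedMonotoneAlong_iff_reflTransGen] at h ⊢
  exact fun v => Relation.ReflTransGen.mono (fun _ _ => Supports.congr hc) _ _ (h v)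

/-- Monotonicity is inherited by directions that do not reverse any edge. -/
theorem RootedMonotoneAlong.of_refines {d' : Plane}
    (hd : ∀ u v, G.graph.Adj u v → inner ℝ d (u : Plane) ≤ inner ℝ d (v : Plane) →
      inner ℝ d' (u : Plane) ≤ inner ℝ d' (v : Plane))
    (h : G.RootedMonotoneAlong d) : G.RootedMonotoneAlong d' := by
  have key : ∀ {u v : G.verts} (w : G.graph.Walk u v),
      ((G.coordsAlong d w).IsChain (· ≤ ·) → (G.coordsAlong d' w).IsChain (· ≤ ·)) ∧
      ((G.coordsAlong d w).IsChain (· ≥ ·) → (G.coordsAlong d' w).IsChain (· ≥ ·)) := by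
    intro u v w
    induction w with
    | nil => simp [coordsAlong]
    | @cons u x v hux w ih =>
      simp only [isChain_coordsAlong_cons]
      exact ⟨fun h => ⟨hd _ _ hux h.1, ih.1 h.2⟩, fun h => ⟨hd _ _ hux.symm h.1, ih.2 h.2⟩⟩
  intro v
  obtain ⟨w, hp, hw⟩ := h v
  exact ⟨w, hp, hw.imp (key w).1 (key w).2⟩

/-! ### General position and the local criterion -/

theorem InGeneralPosition.eq_or_eq_of_inner_eq (hG : G.InGeneralPosition) (hd : d ≠ 0)
    {u v w : G.verts} (huv : u ≠ v) (hu : inner ℝ d (u : Plane) = inner ℝ d (v : Plane))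
    (hw : inner ℝ d (w : Plane) = inner ℝ d (v : Plane)) : w = u ∨ w = v := by
  by_contra! hne
  refine hG u u.2 v v.2 w w.2 (Subtype.coe_injective.ne huv)
    (Subtype.coe_injective.ne hne.1.symm) (Subtype.coe_injective.ne hne.2.symm) ?_
  rw [inner_eq, inner_eq] at hu hw
  rw [collinear_iff_of_mem (p₀ := (v : Plane)) (by simp)]
  -- The level line through `v` has the direction of `d` turned by a right angle.
  refine ⟨!₂[- d 1, d 0], ?_⟩
  have hdd := sq_add_sq_pos_of_ne_zero hd
  have main : ∀ p : Plane, d 0 * p 0 + d 1 * p 1 = d 0 * (v : Plane) 0 + d 1 * (v : Plane) 1 →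
      ∃ r : ℝ, p = r • !₂[- d 1, d 0] +ᵥ (v : Plane) := by
    intro p hp
    refine ⟨((p 1 - (v : Plane) 1) * d 0 - (p 0 - (v : Plane) 0) * d 1) /
      (d 0 ^ 2 + d 1 ^ 2), ?_⟩
    ext i
    fin_cases i
    · simp
      field_simp
      linear_combination d 0 * hp
    · simp
      field_simp
      linear_combination d 1 * hp
  intro p hp
  simp only [Set.mem_insert_iff, Set.mem_singleton_iff] at hp
  rcases hp with rfl | rfl | rfl
  · exact main _ hu
  · exact main _ rfl
  · exact main _ hw

/-- In general position, monotonicity along `d` is a condition on the neighbourhoods. -/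
theorem rootedMonotoneAlong_iff_local (hG : G.InGeneralPosition) (hd : d ≠ 0) :
    G.RootedMonotoneAlong d ↔
      (∀ v, v ≠ G.root → ∃ u, G.Supports d u v) ∧
      ∀ u v, G.graph.Adj u v → u ≠ G.root → v ≠ G.root → G.height d u = G.height d v →
        (∃ w, w ≠ u ∧ G.Supports d w v) ∨ ∃ w, w ≠ v ∧ G.Supports d w u := by
  rw [rootedMonotoneAlong_iff_reflTransGen]
  constructor
  · intro h
    refine ⟨fun v hv => ?_, fun u v _ hu hv _ => ?_⟩
    · obtain h' | ⟨u, -, hu⟩ := Relation.ReflTransGen.cases_tail (h v)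
      · exact absurd h' hv
      · exact ⟨u, hu⟩
    · by_contra! hc
      -- If `u` and `v` have no supporters but each other, no chain of supporters from the root
      -- enters the pair.
      have : ∀ x, Relation.ReflTransGen (G.Supports d) G.root x → x ≠ u ∧ x ≠ v := by
        intro x hx
        induction hx with
        | refl => exact ⟨hu.symm, hv.symm⟩
        | @tail x y _ hxy ih =>
          refine ⟨?_, ?_⟩
          · rintro rfl
            exact hc.2 _ ih.2 hxy
          · rintro rfl
            exact hc.1 _ ih.1 hxy
      exact (this u (h u)).1 rfl
  · rintro ⟨h1, h2⟩
    by_contra! hc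
    -- Take an unreachable vertex of least absolute height. Its supporters are unreachable too, and
    -- being between the root and it they must be tied with it.
    obtain ⟨v, hv, hmin⟩ := Set.exists_min_image
      {v | ¬ Relation.ReflTransGen (G.Supports d) G.root v} (fun v => |G.height d v|)
      (Set.toFinite _) hc
    have hroot : ∀ x, ¬ Relation.ReflTransGen (G.Supports d) G.root x → x ≠ G.root := by
      rintro x hx rfl
      exact hx .refl
    have tie : ∀ x y, ¬ Relation.ReflTransGen (G.Supports d) G.root x →
        G.height d x = G.height d v → G.Supports d y x →
        ¬ Relation.ReflTransGen (G.Supports d) G.root y ∧ G.height d y = G.height d v := by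
      intro x y hx hxv hyx
      have hy : ¬ Relation.ReflTransGen (G.Supports d) G.root y := fun hy => hx (hy.tail hyx)
      refine ⟨hy, ?_⟩
      have hle := hmin y hy
      have h3 := hyx.2
      rw [hxv] at h3
      have h4 := sq_le_sq.2 hle
      nlinarith [sq_nonneg (G.height d v - G.height d y)]
    obtain ⟨u, hu⟩ := h1 v (hroot v hv)
    obtain ⟨hu', huv⟩ := tie v u hv rfl hu
    -- The level of `u` and `v` has no room for a third vertex, while the further supporter given by
    -- `h2` would have to be tied with them.
    have absurd_of_three : ∀ w, w ≠ u → w ≠ v → G.height d w = G.height d v → False :=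
      fun w hwu hwv hw => (hG.eq_or_eq_of_inner_eq hd hu.1.ne (sub_left_injective huv)
        (sub_left_injective hw)).elim hwu hwv
    rcases h2 u v hu.1 (hroot u hu') (hroot v hv) huv with ⟨w, hwu, hw⟩ | ⟨w, hwv, hw⟩
    · exact absurd_of_three w hwu hw.1.ne (tie v w hv rfl hw).2
    · exact absurd_of_three w hw.1.ne hwv (tie u w hu' huv hw).2

end RootedGeometricGraph

/-! ### Reduction to directions orthogonal to edges -/

namespace RootedGeometricGraph

variable {G : RootedGeometricGraph} {d : Plane}

/-- In the plane, vectors orthogonal to the same nonzero vector are parallel: `hcross` is the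
vanishing of their determinant, and `c` is the projection coefficient. -/
theorem exists_height_eq_mul {d' : Plane} (hd : d ≠ 0) {u v : G.verts} (huv : u ≠ v)
    (h : inner ℝ d (u : Plane) = inner ℝ d (v : Plane))
    (h' : inner ℝ d' (u : Plane) = inner ℝ d' (v : Plane)) :
    ∃ c, ∀ x, G.height d' x = c * G.height d x := by
  have hdd := sq_add_sq_pos_of_ne_zero hd
  have he : (u : Plane) - (v : Plane) ≠ 0 := sub_ne_zero.2 (Subtype.coe_injective.ne huv)
  have hee := sq_add_sq_pos_of_ne_zero he
  simp only [PiLp.sub_apply] at hee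
  rw [inner_eq, inner_eq] at h h'
  set e0 := (u : Plane) 0 - (v : Plane) 0
  set e1 := (u : Plane) 1 - (v : Plane) 1
  have h1 : d 0 * e0 + d 1 * e1 = 0 := by simp only [e0, e1]; linarith
  have h2 : d' 0 * e0 + d' 1 * e1 = 0 := by simp only [e0, e1]; linarith
  have hcross : d 0 * d' 1 - d 1 * d' 0 = 0 := by
    have : (d 0 * d' 1 - d 1 * d' 0) * (e0 ^ 2 + e1 ^ 2) = 0 := by
      linear_combination (d' 1 * e0 - d' 0 * e1) * h1 + (d 0 * e1 - d 1 * e0) * h2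
    exact (mul_eq_zero.1 this).resolve_right hee.ne'
  refine ⟨(d 0 * d' 0 + d 1 * d' 1) / (d 0 ^ 2 + d 1 ^ 2), fun x => ?_⟩
  simp only [height, inner_eq]
  field_simp
  linear_combination (((x : Plane) 1 - (G.root : Plane) 1) * d 0 -
    ((x : Plane) 0 - (G.root : Plane) 0) * d 1) * hcross

theorem rootedUniformMonotone_iff_exists_adj (hE : ∃ u v, G.graph.Adj u v) :
    G.RootedUniformMonotone ↔ ∃ u v, G.graph.Adj u v ∧ ∃ d : Plane, d ≠ 0 ∧
      inner ℝ d (u : Plane) = inner ℝ d (v : Plane) ∧ G.RootedMonotoneAlong d := by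
  refine ⟨?_, fun ⟨u, v, _, d, hd, _, h⟩ => ⟨d, hd, h⟩⟩
  rintro ⟨d, hd, h⟩
  by_cases htie : ∃ u v, G.graph.Adj u v ∧ inner ℝ d (u : Plane) = inner ℝ d (v : Plane)
  · obtain ⟨u, v, huv, ht⟩ := htie
    exact ⟨u, v, huv, d, hd, ht, h⟩
  push Not at htie
  have hdd := sq_add_sq_pos_of_ne_zero hd
  obtain ⟨u, v, huv⟩ := hE
  -- In the frame of `d` and `d` turned by a right angle, minimize the slope of the edges; it does
  -- not depend on their orientation. With `ρ` the minimum, the turned vector minus `ρ • d` is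
  -- orthogonal to a minimizing edge and nonnegative on each edge that ascends along `d`.
  obtain ⟨⟨u, v⟩, huv, hmin⟩ := Set.exists_min_image
    {p : G.verts × G.verts | G.graph.Adj p.1 p.2}
    (fun p => (- d 1 * ((p.2 : Plane) 0 - (p.1 : Plane) 0) +
      d 0 * ((p.2 : Plane) 1 - (p.1 : Plane) 1)) /
      (inner ℝ d (p.2 : Plane) - inner ℝ d (p.1 : Plane))) (Set.toFinite _) ⟨(u, v), huv⟩
  simp only [Set.mem_ofPred_eq, Prod.forall] at huv hmin
  set ρ := (- d 1 * ((v : Plane) 0 - (u : Plane) 0) + d 0 * ((v : Plane) 1 - (u : Plane) 1)) /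
      (inner ℝ d (v : Plane) - inner ℝ d (u : Plane)) with hρ
  have hne : inner ℝ d (v : Plane) - inner ℝ d (u : Plane) ≠ 0 :=
    sub_ne_zero.2 (htie u v huv).symm
  have hρ' := div_mul_cancel₀ (- d 1 * ((v : Plane) 0 - (u : Plane) 0) +
    d 0 * ((v : Plane) 1 - (u : Plane) 1)) hne
  rw [← hρ] at hρ'
  refine ⟨u, v, huv, !₂[- d 1 - ρ * d 0, d 0 - ρ * d 1], ?_, ?_, ?_⟩
  · intro h0
    have h00 := congrArg (fun p : Plane => p 0) h0
    have h01 := congrArg (fun p : Plane => p 1) h0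
    simp only [Matrix.cons_val_zero, Matrix.cons_val_one, PiLp.zero_apply] at h00 h01
    -- The inner product of the new direction with `d` turned by a right angle is the squared length
    -- of `d`.
    refine hdd.ne' ?_
    linear_combination d 0 * h01 - d 1 * h00
  · simp only [inner_eq] at hρ' ⊢
    simp only [Matrix.cons_val_zero, Matrix.cons_val_one]
    linear_combination hρ'
  · refine h.of_refines fun x y hxy hle => ?_
    have hlt := lt_of_le_of_ne hle (htie x y hxy)
    have h1 := hmin x y hxy
    rw [le_div_iff₀ (sub_pos.2 hlt)] at h1
    simp only [inner_eq] at h1 ⊢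
    simp only [Matrix.cons_val_zero, Matrix.cons_val_one]
    linarith

end RootedGeometricGraph

/-! ### Arcs, the times at which they support their targets, and their weights -/

namespace RealRAM

/-- The vertices `u` and `v` are at the same height `X + t * Y` at this time `t`. -/
noncomputable def tieTime (X Y : ℕ → ℝ) (u v : ℕ) : ℝ := (X u - X v) / (Y v - Y u)

/-- The time from which on `u` supports `v` (again). -/
noncomputable def actTime (X Y : ℕ → ℝ) (r u v : ℕ) : ℝ :=
  if u = r ∨ v = r then tieTime X Y u v
  else if (Y u - Y r) * (Y v - Y u) < 0 then min (tieTime X Y r u) (tieTime X Y u v)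
  else max (tieTime X Y r u) (tieTime X Y u v)

/-- The time after which `u` does not support `v` (for a while). -/
noncomputable def deactTime (X Y : ℕ → ℝ) (r u v : ℕ) : ℝ :=
  if u = r ∨ v = r then tieTime X Y u v
  else if (Y u - Y r) * (Y v - Y u) < 0 then max (tieTime X Y r u) (tieTime X Y u v)
  else min (tieTime X Y r u) (tieTime X Y u v)

/-- Whether `u` supports `v` at the very beginning. -/
noncomputable def initWeight (Y : ℕ → ℝ) (r u v : ℕ) : ℕ :=
  if u = r ∨ v = r then 1 else if (Y u - Y r) * (Y v - Y u) < 0 then 0 else 1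

/-- The weight of the arc from `u` to `v` at time `t`; it is positive when `u` supports `v`. -/
noncomputable def weight (X Y : ℕ → ℝ) (r u v : ℕ) (t : ℝ) : ℕ :=
  initWeight Y r u v + (if actTime X Y r u v ≤ t then 1 else 0) -
    (if deactTime X Y r u v < t then 1 else 0)

variable {X Y : ℕ → ℝ} {r u v : ℕ} {t : ℝ}

theorem one_le_weight_of_root (h : u = r ∨ v = r) : 1 ≤ weight X Y r u v t := by
  simp only [weight, initWeight, actTime, deactTime, if_pos h]
  split_ifs <;> first | omega | (exfalso; linarith)

/-- Both times of such an arc are its tie; there the activation already counts and the deactivation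
does not yet. The value two keeps pairs that contain the root from being taken for pairs with
counters one. -/
theorem weight_tieTime_of_root (h : u = r ∨ v = r) :
    weight X Y r u v (tieTime X Y u v) = 2 := by
  simp [weight, initWeight, actTime, deactTime, if_pos h]

theorem tieTime_eq_iff (h : Y v ≠ Y u) : tieTime X Y u v = t ↔ X u + t * Y u = X v + t * Y v := by
  rw [tieTime, div_eq_iff (sub_ne_zero.2 h)]
  constructor <;> intro h <;> linarith

/-- The product is quadratic in `t`, with roots `p`, `q` and leading coefficient `(Y u - Y r) * (Y v
- Y u)`. If this is negative, support holds between the roots and the weight starts at 0; if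
positive, support holds outside them and the weight starts at 1. In the latter case a double root
would have weight 2, which `hne` excludes. -/
theorem weight_eq_ite (hu : u ≠ r) (hv : v ≠ r) (hru : Y u ≠ Y r) (huv : Y v ≠ Y u)
    (hne : tieTime X Y r u ≠ tieTime X Y u v) :
    weight X Y r u v t = 1 ∧
      0 ≤ (X u - X r + t * (Y u - Y r)) * (X v - X u + t * (Y v - Y u)) ∨
    weight X Y r u v t = 0 ∧
      (X u - X r + t * (Y u - Y r)) * (X v - X u + t * (Y v - Y u)) < 0 := by
  have h1 : X u - X r + t * (Y u - Y r) = (Y u - Y r) * (t - tieTime X Y r u) := by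
    have := sub_ne_zero.2 hru
    rw [tieTime]; field_simp; ring
  have h2 : X v - X u + t * (Y v - Y u) = (Y v - Y u) * (t - tieTime X Y u v) := by
    have := sub_ne_zero.2 huv
    rw [tieTime]; field_simp; ring
  rw [h1, h2, show ∀ a b c d : ℝ, a * b * (c * d) = a * c * (b * d) by intros; ring]
  have h3 : (Y u - Y r) * (Y v - Y u) ≠ 0 := mul_ne_zero (sub_ne_zero.2 hru) (sub_ne_zero.2 huv)
  set p := tieTime X Y r u
  set q := tieTime X Y u v
  have hr : ¬ (u = r ∨ v = r) := by tauto
  simp only [weight, initWeight, actTime, deactTime, if_neg hr]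
  rcases lt_or_gt_of_ne h3 with h | h
  · simp only [if_pos h]
    have hiff : 0 ≤ (Y u - Y r) * (Y v - Y u) * ((t - p) * (t - q)) ↔ (t - p) * (t - q) ≤ 0 := by
      constructor <;> intro h' <;> nlinarith
    rw [hiff, (not_le.symm.trans hiff.not).trans not_le]
    rcases le_total p q with hpq | hpq
    · rw [min_eq_left hpq, max_eq_right hpq]
      split_ifs with ha hb hb
      · exact .inr ⟨rfl, by nlinarith⟩
      · exact .inl ⟨rfl, by nlinarith⟩
      · exfalso; linarith
      · exact .inr ⟨rfl, by nlinarith⟩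
    · rw [min_eq_right hpq, max_eq_left hpq]
      split_ifs with ha hb hb
      · exact .inr ⟨rfl, by nlinarith⟩
      · exact .inl ⟨rfl, by nlinarith⟩
      · exfalso; linarith
      · exact .inr ⟨rfl, by nlinarith⟩
  · simp only [if_neg h.le.not_gt]
    have hiff : 0 ≤ (Y u - Y r) * (Y v - Y u) * ((t - p) * (t - q)) ↔ 0 ≤ (t - p) * (t - q) := by
      constructor <;> intro h' <;> nlinarith
    rw [hiff, (not_le.symm.trans hiff.not).trans not_le]
    rcases lt_or_gt_of_ne hne with hpq | hpq
    · rw [min_eq_left hpq.le, max_eq_right hpq.le]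
      split_ifs with ha hb hb
      · exact .inl ⟨rfl, by nlinarith⟩
      · exfalso; linarith
      · exact .inr ⟨rfl, by nlinarith⟩
      · exact .inl ⟨rfl, by nlinarith⟩
    · rw [min_eq_right hpq.le, max_eq_left hpq.le]
      split_ifs with ha hb hb
      · exact .inl ⟨rfl, by nlinarith⟩
      · exfalso; linarith
      · exact .inr ⟨rfl, by nlinarith⟩
      · exact .inl ⟨rfl, by nlinarith⟩

/-- The number of supporters of the vertex `v` at time `t`, with multiplicities, over the arcs
with sources `src a` and targets `tgt a`, for `a < N`. The root always supports itself. -/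
noncomputable def count (X Y : ℕ → ℝ) (r N : ℕ) (src tgt : ℕ → ℕ) (v : ℕ) (t : ℝ) : ℕ :=
  (if v = r then 1 else 0) +
    ∑ a ∈ Finset.range N with tgt a = v, weight X Y r (src a) (tgt a) t

end RealRAM

namespace RealRAM

/-! ### The combinatorial criterion -/

/-- The sequences `pv`, `src`, `tgt` list the `n` vertices and the `N` arcs (oriented edges) of
`G`, where the root has number `r`. -/
structure Lists (G : RootedGeometricGraph) (n N r : ℕ) (src tgt : ℕ → ℕ) (pv : ℕ → G.verts) :
    Prop where
  inj : ∀ i < n, ∀ j < n, pv i = pv j → i = j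
  surj : ∀ v, ∃ i < n, pv i = v
  root_lt : r < n
  root : pv r = G.root
  src_lt : ∀ a < N, src a < n
  tgt_lt : ∀ a < N, tgt a < n
  adj : ∀ a < N, G.graph.Adj (pv (src a)) (pv (tgt a))
  exists_arc : ∀ u < n, ∀ v < n, G.graph.Adj (pv u) (pv v) → ∃ a < N, src a = u ∧ tgt a = v
  arc_inj : ∀ a < N, ∀ b < N, src a = src b → tgt a = tgt b → a = b

/-- The sequences `X`, `Y` list the coordinates of the vertices after a shear that leaves no arc,
and no segment from the root to the source of an arc, horizontal. -/
structure Coords (G : RootedGeometricGraph) (n N r : ℕ) (src tgt : ℕ → ℕ) (pv : ℕ → G.verts)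
    (δ : ℝ) (X Y : ℕ → ℝ) : Prop where
  fst : ∀ i < n, X i = (pv i : Plane) 0
  snd : ∀ i < n, Y i = (pv i : Plane) 1 + δ * (pv i : Plane) 0
  arc_ne : ∀ a < N, Y (tgt a) ≠ Y (src a)
  root_ne : ∀ a < N, src a ≠ r → Y (src a) ≠ Y r

/-- At the time of the tie of the arc `a`, every vertex is supported, and there are no two
tied vertices each supported by the other one only. -/
def Check (X Y : ℕ → ℝ) (n r N : ℕ) (src tgt : ℕ → ℕ) (t : ℝ) : Prop :=
  (∀ v < n, 0 < count X Y r N src tgt v t) ∧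
    ∀ b < N, tieTime X Y (src b) (tgt b) = t →
      ¬ (count X Y r N src tgt (src b) t = 1 ∧ count X Y r N src tgt (tgt b) t = 1)

section

variable {G : RootedGeometricGraph} {n N r : ℕ} {src tgt : ℕ → ℕ} {pv : ℕ → G.verts}
  {δ t : ℝ} {X Y : ℕ → ℝ}

/-- The direction along which the heights are `X + t * Y` after the shear. -/
noncomputable def sweepDir (δ t : ℝ) : Plane := !₂[1 + t * δ, t]

theorem sweepDir_ne_zero : sweepDir δ t ≠ 0 := by
  intro h
  have h0 := congrArg (fun p : Plane => p 0) h
  have h1 := congrArg (fun p : Plane => p 1) h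
  simp only [sweepDir, Matrix.cons_val_zero, Matrix.cons_val_one, PiLp.zero_apply] at h0 h1
  rw [h1] at h0
  simp at h0

theorem Coords.inner_sweepDir (hC : Coords G n N r src tgt pv δ X Y) {i : ℕ} (hi : i < n) :
    inner ℝ (sweepDir δ t) (pv i : Plane) = X i + t * Y i := by
  rw [RootedGeometricGraph.inner_eq, hC.fst i hi, hC.snd i hi]
  simp only [sweepDir, Matrix.cons_val_zero, Matrix.cons_val_one]
  ring

theorem Coords.height_sweepDir (hC : Coords G n N r src tgt pv δ X Y)
    (hL : Lists G n N r src tgt pv) {i : ℕ} (hi : i < n) :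
    G.height (sweepDir δ t) (pv i) = X i - X r + t * (Y i - Y r) := by
  rw [RootedGeometricGraph.height, ← hL.root, hC.inner_sweepDir hi, hC.inner_sweepDir hL.root_lt]
  ring

theorem Coords.tie_iff (hC : Coords G n N r src tgt pv δ X Y) (hL : Lists G n N r src tgt pv)
    {a : ℕ} (ha : a < N) : tieTime X Y (src a) (tgt a) = t ↔
      inner ℝ (sweepDir δ t) (pv (src a) : Plane) = inner ℝ (sweepDir δ t) (pv (tgt a) : Plane) := by
  rw [tieTime_eq_iff (hC.arc_ne a ha), hC.inner_sweepDir (hL.src_lt a ha),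
    hC.inner_sweepDir (hL.tgt_lt a ha)]

theorem Lists.ne_root (hL : Lists G n N r src tgt pv) {i : ℕ} (hi : i < n) (h : i ≠ r) :
    pv i ≠ G.root := by
  rw [← hL.root]
  exact fun h' => h (hL.inj i hi r hL.root_lt h')

theorem Lists.src_ne_tgt (hL : Lists G n N r src tgt pv) {a : ℕ} (ha : a < N) :
    src a ≠ tgt a := fun h => (hL.adj a ha).ne (congrArg pv h)

/-- Equal tie times would put the root and both ends of the arc on one level line, against general
position; so the two roots in `weight_eq_ite` are distinct. -/
theorem Coords.weight_eq (hC : Coords G n N r src tgt pv δ X Y) (hL : Lists G n N r src tgt pv)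
    (hG : G.InGeneralPosition) {a : ℕ} (ha : a < N) (hs : src a ≠ r) (ht : tgt a ≠ r) :
    weight X Y r (src a) (tgt a) t = 1 ∧
      G.Supports (sweepDir δ t) (pv (src a)) (pv (tgt a)) ∨
    weight X Y r (src a) (tgt a) t = 0 ∧
      ¬ G.Supports (sweepDir δ t) (pv (src a)) (pv (tgt a)) := by
  have hne : tieTime X Y r (src a) ≠ tieTime X Y (src a) (tgt a) := by
    intro h
    have h1 := (hC.tie_iff hL ha).1 h.symm
    have h2 := (tieTime_eq_iff (X := X) (hC.root_ne a ha hs)).1 rfl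
    rw [← hC.inner_sweepDir hL.root_lt (δ := δ), ← hC.inner_sweepDir (hL.src_lt a ha) (δ := δ)]
      at h2
    rcases hG.eq_or_eq_of_inner_eq sweepDir_ne_zero (hL.adj a ha).ne h1 (h2.trans h1) with h | h
    · exact hs (hL.inj _ hL.root_lt _ (hL.src_lt a ha) h).symm
    · exact ht (hL.inj _ hL.root_lt _ (hL.tgt_lt a ha) h).symm
  have key : G.Supports (sweepDir δ t) (pv (src a)) (pv (tgt a)) ↔
      0 ≤ (X (src a) - X r + t * (Y (src a) - Y r)) *
        (X (tgt a) - X (src a) + t * (Y (tgt a) - Y (src a))) := by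
    rw [RootedGeometricGraph.Supports, hC.height_sweepDir hL (hL.src_lt a ha),
      hC.height_sweepDir hL (hL.tgt_lt a ha), and_iff_right (hL.adj a ha)]
    ring_nf
  rw [key, not_le]
  exact weight_eq_ite hs ht (hC.root_ne a ha hs) (hC.arc_ne a ha) hne

theorem Coords.one_le_weight_iff (hC : Coords G n N r src tgt pv δ X Y)
    (hL : Lists G n N r src tgt pv) (hG : G.InGeneralPosition) {a : ℕ} (ha : a < N)
    (ht : tgt a ≠ r) : 1 ≤ weight X Y r (src a) (tgt a) t ↔
      G.Supports (sweepDir δ t) (pv (src a)) (pv (tgt a)) := by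
  by_cases hs : src a = r
  · refine iff_of_true (one_le_weight_of_root (.inl hs)) ⟨hL.adj a ha, ?_⟩
    rw [hs, hL.root, RootedGeometricGraph.height_root, zero_mul]
  · rcases hC.weight_eq hL hG ha hs ht (t := t) with ⟨h1, h2⟩ | ⟨h1, h2⟩ <;> simp [h1, h2]

theorem weight_le_count {a : ℕ} (ha : a < N) :
    weight X Y r (src a) (tgt a) t ≤ count X Y r N src tgt (tgt a) t :=
  (Finset.single_le_sum (f := fun b => weight X Y r (src b) (tgt b) t) (fun _ _ => Nat.zero_le _)
    (by simp [ha])).trans (Nat.le_add_left _ _)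

theorem weight_add_weight_le_count {a b : ℕ} (ha : a < N) (hb : b < N) (hab : a ≠ b)
    (h : tgt b = tgt a) : weight X Y r (src a) (tgt a) t + weight X Y r (src b) (tgt b) t ≤
      count X Y r N src tgt (tgt a) t := by
  refine le_trans ?_ (Nat.le_add_left _ _)
  rw [← Finset.sum_pair (f := fun b => weight X Y r (src b) (tgt b) t) hab]
  refine Finset.sum_le_sum_of_subset fun c hc => ?_
  simp only [Finset.mem_insert, Finset.mem_singleton] at hc
  rcases hc with rfl | rfl <;> simp [ha, hb, h]

theorem Coords.count_pos_iff (hC : Coords G n N r src tgt pv δ X Y)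
    (hL : Lists G n N r src tgt pv) (hG : G.InGeneralPosition) {v : ℕ} (hv : v < n) (hvr : v ≠ r) :
    0 < count X Y r N src tgt v t ↔ ∃ u, G.Supports (sweepDir δ t) u (pv v) := by
  constructor
  · intro h
    rw [count, if_neg hvr, zero_add] at h
    obtain ⟨a, ha, hpos⟩ := Finset.sum_pos_iff.1 h
    simp only [Finset.mem_filter, Finset.mem_range] at ha
    obtain ⟨ha, rfl⟩ := ha
    exact ⟨_, (hC.one_le_weight_iff hL hG ha hvr).1 hpos⟩
  · rintro ⟨u, hu⟩
    obtain ⟨i, hi, rfl⟩ := hL.surj u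
    obtain ⟨a, ha, rfl, rfl⟩ := hL.exists_arc i hi v hv hu.1
    exact ((hC.one_le_weight_iff hL hG ha hvr).2 hu).trans (weight_le_count ha)

/-- A vertex tied with a supporter has another supporter iff it does not have weight one. -/
theorem Coords.count_eq_one_iff (hC : Coords G n N r src tgt pv δ X Y)
    (hL : Lists G n N r src tgt pv) (hG : G.InGeneralPosition) {a : ℕ} (ha : a < N)
    (hs : src a ≠ r) (ht : tgt a ≠ r)
    (htie : G.height (sweepDir δ t) (pv (src a)) = G.height (sweepDir δ t) (pv (tgt a))) :
    count X Y r N src tgt (tgt a) t = 1 ↔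
      ¬ ∃ w, w ≠ pv (src a) ∧ G.Supports (sweepDir δ t) w (pv (tgt a)) := by
  -- A tied neighbour is a supporter, so the arc `a` itself contributes exactly one and the other
  -- arcs decide.
  have hw : weight X Y r (src a) (tgt a) t = 1 := by
    rcases hC.weight_eq hL hG ha hs ht (t := t) with ⟨h, -⟩ | ⟨-, h⟩
    · exact h
    · exact absurd ⟨hL.adj a ha, by rw [htie, sub_self, mul_zero]⟩ h
  constructor
  · rintro h1 ⟨w, hne, hsup⟩
    obtain ⟨i, hi, rfl⟩ := hL.surj w
    obtain ⟨b, hb, rfl, hbt⟩ := hL.exists_arc i hi _ (hL.tgt_lt a ha) hsup.1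
    have h2 := weight_add_weight_le_count (X := X) (Y := Y) (r := r) (src := src) (t := t) ha hb
      (fun h => hne (by rw [h])) hbt
    rw [← hbt] at hsup
    have h3 := (hC.one_le_weight_iff hL hG hb (hbt ▸ ht)).2 hsup
    omega
  · intro h
    have hmem : a ∈ {b ∈ Finset.range N | tgt b = tgt a} := by simp [ha]
    rw [count, if_neg ht, zero_add, ← Finset.add_sum_erase _ _ hmem, hw, Nat.add_eq_left]
    refine Finset.sum_eq_zero fun b hb => ?_
    simp only [Finset.mem_erase, Finset.mem_filter, Finset.mem_range] at hb
    obtain ⟨hba, hb, hbt⟩ := hb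
    by_contra hne
    have h3 := (hC.one_le_weight_iff hL hG hb (hbt ▸ ht)).1 (Nat.one_le_iff_ne_zero.2 hne)
    rw [hbt] at h3
    refine h ⟨_, fun h' => hba ?_, h3⟩
    exact hL.arc_inj b hb a ha (hL.inj _ (hL.src_lt b hb) _ (hL.src_lt a ha) h') hbt

/-- Positive counters express the first half of `rootedMonotoneAlong_iff_local`, the root being
covered by its own unit; the test for counters one expresses the second half. -/
theorem Coords.check_iff (hC : Coords G n N r src tgt pv δ X Y)
    (hL : Lists G n N r src tgt pv) (hG : G.InGeneralPosition) :
    Check X Y n r N src tgt t ↔ G.RootedMonotoneAlong (sweepDir δ t) := by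
  rw [RootedGeometricGraph.rootedMonotoneAlong_iff_local hG sweepDir_ne_zero, Check]
  refine and_congr ?_ ?_
  · constructor
    · intro h v hv
      obtain ⟨i, hi, rfl⟩ := hL.surj v
      exact (hC.count_pos_iff hL hG hi fun h => hv (h ▸ hL.root)).1 (h i hi)
    · intro h v hv
      by_cases hvr : v = r
      · simp [count, hvr]
      · exact (hC.count_pos_iff hL hG hv hvr).2 (h _ (hL.ne_root hv hvr))
  · constructor
    · intro h u v huv hu hv htie
      obtain ⟨i, hi, rfl⟩ := hL.surj u
      obtain ⟨j, hj, rfl⟩ := hL.surj v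
      obtain ⟨a, ha, rfl, rfl⟩ := hL.exists_arc i hi j hj huv
      obtain ⟨b, hb, hb1, hb2⟩ := hL.exists_arc _ hj _ hi huv.symm
      have hs : src a ≠ r := fun h => hu (h ▸ hL.root)
      have ht : tgt a ≠ r := fun h => hv (h ▸ hL.root)
      have h1 := hC.count_eq_one_iff hL hG ha hs ht htie
      have h2 := hC.count_eq_one_iff hL hG hb (hb1 ▸ ht) (hb2 ▸ hs) (by rw [hb1, hb2, htie])
      rw [hb1, hb2] at h2
      have h3 := h a ha ((hC.tie_iff hL ha).2 (sub_left_injective htie))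
      rw [h1, h2, not_and_or, not_not, not_not] at h3
      exact h3.symm
    · rintro h b hb hbt ⟨h1, h2⟩
      have htie : G.height (sweepDir δ t) (pv (src b)) = G.height (sweepDir δ t) (pv (tgt b)) :=
        congrArg (· - _) ((hC.tie_iff hL hb).1 hbt)
      obtain ⟨c, hc, hc1, hc2⟩ := hL.exists_arc _ (hL.tgt_lt b hb) _ (hL.src_lt b hb)
        (hL.adj b hb).symm
      -- The local criterion exempts pairs containing the root. The test exempts them as well: the
      -- arc alone gives its target a counter of at least two.
      by_cases hroot : src b = r ∨ tgt b = r
      · have h3 := weight_le_count (X := X) (Y := Y) (r := r) (src := src) (tgt := tgt) (t := t) hb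
        rw [← hbt, weight_tieTime_of_root hroot, hbt] at h3
        omega
      · push Not at hroot
        have h3 := hC.count_eq_one_iff hL hG hb hroot.1 hroot.2 htie
        have h4 := hC.count_eq_one_iff hL hG hc (hc1 ▸ hroot.2) (hc2 ▸ hroot.1)
          (by rw [hc1, hc2, htie])
        rw [hc1, hc2] at h4
        have h5 := h _ _ (hL.adj b hb) (hL.ne_root (hL.src_lt b hb) hroot.1)
          (hL.ne_root (hL.tgt_lt b hb) hroot.2) htie
        exact h5.elim (h3.1 h2) (h4.1 h1)

/-- The criterion that the program evaluates. -/
theorem Coords.rootedUniformMonotone_iff (hC : Coords G n N r src tgt pv δ X Y)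
    (hL : Lists G n N r src tgt pv) (hG : G.InGeneralPosition) (hN : 0 < N) :
    G.RootedUniformMonotone ↔
      ∃ a < N, Check X Y n r N src tgt (tieTime X Y (src a) (tgt a)) := by
  rw [RootedGeometricGraph.rootedUniformMonotone_iff_exists_adj ⟨_, _, hL.adj 0 hN⟩]
  constructor
  · rintro ⟨u, v, huv, d, hd, htie, h⟩
    obtain ⟨i, hi, rfl⟩ := hL.surj u
    obtain ⟨j, hj, rfl⟩ := hL.surj v
    obtain ⟨a, ha, rfl, rfl⟩ := hL.exists_arc i hi j hj huv
    refine ⟨a, ha, (hC.check_iff hL hG).2 ?_⟩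
    -- The direction `d` and the sweep direction at the tie of the arc are orthogonal to the same
    -- edge, hence parallel.
    obtain ⟨c, hc⟩ := RootedGeometricGraph.exists_height_eq_mul hd huv.ne htie
      ((hC.tie_iff hL ha).1 rfl)
    exact h.of_height_eq_mul hc
  · rintro ⟨a, ha, h⟩
    exact ⟨_, _, hL.adj a ha, _, sweepDir_ne_zero, (hC.tie_iff hL ha).1 rfl,
      (hC.check_iff hL hG).1 h⟩

end

end RealRAM

namespace RealRAM

/-! ### Preparation of the sweep -/

/-! ### Memory after a single write -/

section

variable (s : State) (x y v i : ℕ) (w : ℝ)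

@[simp] theorem State.setI_ivar : (s.setI x v).ivar y = if y = x then v else s.ivar y :=
  Function.update_apply ..
@[simp] theorem State.setI_rvar : (s.setI x v).rvar = s.rvar := rfl
@[simp] theorem State.setI_iarr : (s.setI x v).iarr = s.iarr := rfl
@[simp] theorem State.setI_rarr : (s.setI x v).rarr = s.rarr := rfl
@[simp] theorem State.setR_ivar : (s.setR x w).ivar = s.ivar := rfl
@[simp] theorem State.setR_rvar : (s.setR x w).rvar y = if y = x then w else s.rvar y :=
  Function.update_apply ..
@[simp] theorem State.setR_iarr : (s.setR x w).iarr = s.iarr := rfl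
@[simp] theorem State.setR_rarr : (s.setR x w).rarr = s.rarr := rfl
@[simp] theorem State.storeI_ivar : (s.storeI x i v).ivar = s.ivar := rfl
@[simp] theorem State.storeI_rvar : (s.storeI x i v).rvar = s.rvar := rfl
@[simp] theorem State.storeI_iarr :
    (s.storeI x i v).iarr y = if y = x then Function.update (s.iarr x) i v else s.iarr y :=
  Function.update_apply ..
@[simp] theorem State.storeI_rarr : (s.storeI x i v).rarr = s.rarr := rfl
@[simp] theorem State.storeR_ivar : (s.storeR x i w).ivar = s.ivar := rfl
@[simp] theorem State.storeR_rvar : (s.storeR x i w).rvar = s.rvar := rfl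
@[simp] theorem State.storeR_iarr : (s.storeR x i w).iarr = s.iarr := rfl
@[simp] theorem State.storeR_rarr :
    (s.storeR x i w).rarr y = if y = x then Function.update (s.rarr x) i w else s.rarr y :=
  Function.update_apply ..

end

theorem Runs.for_loop {W : ℕ} {init p : Prog} {b : BExp} {s : State} {N c : ℕ}
    (I : ℕ → State → Prop) (h0 : init.wp W (I 0) s)
    (hb : ∀ k s, k ≤ N → I k s → (b.Holds s ↔ k < N))
    (hp : ∀ k s, k < N → I k s → Runs W p s c (I (k + 1))) :
    Runs W (.seq init (.loop b p)) s (init.bound + (N * (b.cost + c) + b.cost)) (I N) :=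
  Runs.seq (Prog.wp.runs h0) fun _ h => Runs.loop_up I h hb hp

attribute [simp] Prog.wp IExp.eval RExp.eval BExp.Holds Prog.bound IExp.cost RExp.cost BExp.cost

/-- Lists both orientations of every edge. -/
def listArcs : Prog :=
  .seq (.seq (.setI 3 (.mul (.const 2) (.var 1)))
    (.seq (.setI 4 (.mul (.const 8) (.var 1))) (.setI 5 (.const 0))))
  (.loop (.ilt (.var 5) (.var 1))
    (.seq (.storeI 5 (.var 5) (.get 0 (.var 5)))
    (.seq (.storeI 6 (.var 5) (.get 1 (.var 5)))
    (.seq (.storeI 5 (.add (.var 1) (.var 5)) (.get 1 (.var 5)))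
    (.seq (.storeI 6 (.add (.var 1) (.var 5)) (.get 0 (.var 5)))
    (.setI 5 (.add (.var 5) (.const 1))))))))

/-- Arc `m + j` is the reverse of arc `j`. The value `8 * m` is the number of events, four for each
of the `2 * m` arcs. -/
theorem runs_listArcs {W : ℕ} {s : State} {n m : ℕ} (hm : s.ivar 1 = m)
    (hW : n + 8 * m ≤ W) (he : ∀ j < m, s.iarr 0 j < n ∧ s.iarr 1 j < n) :
    Runs W listArcs s (200 * (m + 1)) fun s' => s'.ivar 3 = 2 * m ∧ s'.ivar 4 = 8 * m ∧
      ∀ j < m, s'.iarr 5 j = s.iarr 0 j ∧ s'.iarr 6 j = s.iarr 1 j ∧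
        s'.iarr 5 (m + j) = s.iarr 1 j ∧ s'.iarr 6 (m + j) = s.iarr 0 j := by
  refine Runs.mono (Runs.for_loop (N := m) (c := 100) (fun k s' => s'.ivar 5 = k ∧ s'.ivar 1 = m ∧
    s'.iarr 0 = s.iarr 0 ∧ s'.iarr 1 = s.iarr 1 ∧ s'.ivar 3 = 2 * m ∧ s'.ivar 4 = 8 * m ∧
      ∀ j < k, s'.iarr 5 j = s.iarr 0 j ∧ s'.iarr 6 j = s.iarr 1 j ∧
        s'.iarr 5 (m + j) = s.iarr 1 j ∧ s'.iarr 6 (m + j) = s.iarr 0 j) ?_ ?_ ?_) ?_ ?_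
  · simp [hm]
    omega
  · rintro k s' - ⟨h5, h1, -⟩
    simp [h5, h1]
  · rintro k s' hk ⟨h5, h1, h0, h0', h3, h4, h⟩
    have := he k hk
    refine (Prog.wp.runs ?_).mono (by simp) fun _ h => h
    simp [h5, h1, h0, h0', h3, h4]
    refine ⟨by omega, by omega, by omega, by omega, by omega, fun j hj => ?_⟩
    rcases hj.lt_or_eq with hj | rfl
    · have := h j hj
      simp [this, show j ≠ m + k by omega, show m + j ≠ k by omega, hj.ne]
    · simp [show m ≠ 0 by omega]
  · simp
    omega
  · rintro s' ⟨-, -, -, -, h⟩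
    exact h

/-- Lowers the first real variable to half of the absolute value of the second one, if the latter
is negative. -/
def lower : Prog :=
  .ite (.and (.rlt (.var 1) (.const 0)) (.rlt (.mul (.const (-1 / 2)) (.var 1)) (.var 0)))
    (.setR 0 (.mul (.const (-1 / 2)) (.var 1))) .skip

/-- Computes a shear factor. -/
def findShear : Prog :=
  .seq (.seq (.setR 0 (.const 1)) (.setI 5 (.const 0)))
  (.loop (.ilt (.var 5) (.var 3))
    (.seq (.setR 1 (.div
      (.sub (.get 1 (.get 6 (.var 5))) (.get 1 (.get 5 (.var 5))))
      (.sub (.get 0 (.get 6 (.var 5))) (.get 0 (.get 5 (.var 5))))))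
    (.seq lower
    (.seq (.setR 1 (.div
      (.sub (.get 1 (.get 5 (.var 5))) (.get 1 (.var 2)))
      (.sub (.get 0 (.get 5 (.var 5))) (.get 0 (.var 2)))))
    (.seq lower
    (.setI 5 (.add (.var 5) (.const 1))))))))

/-- The shear factor starts at 1 and is kept at most half the absolute value of every negative slope
seen. A vertical difference gives the quotient 0, which imposes no constraint. -/
theorem runs_findShear {W : ℕ} {s : State} {N r : ℕ} {src tgt : ℕ → ℕ} {x y : ℕ → ℝ}
    (hN : s.ivar 3 = N) (hr : s.ivar 2 = r) (hW : N ≤ W) (hsrc : s.iarr 5 = src)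
    (htgt : s.iarr 6 = tgt) (hx : s.rarr 0 = x) (hy : s.rarr 1 = y) :
    Runs W findShear s (200 * (N + 1)) fun s' => 0 < s'.rvar 0 ∧ ∀ a < N,
      ((y (tgt a) - y (src a)) / (x (tgt a) - x (src a)) < 0 →
        2 * s'.rvar 0 ≤ - ((y (tgt a) - y (src a)) / (x (tgt a) - x (src a)))) ∧
      ((y (src a) - y r) / (x (src a) - x r) < 0 →
        2 * s'.rvar 0 ≤ - ((y (src a) - y r) / (x (src a) - x r))) := by
  refine Runs.mono (Runs.for_loop (N := N) (c := 150) (fun k s' => (s'.ivar 5 = k ∧ s'.ivar 3 = N ∧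
    s'.ivar 2 = r ∧ s'.iarr 5 = src ∧ s'.iarr 6 = tgt ∧ s'.rarr 0 = x ∧ s'.rarr 1 = y) ∧
      0 < s'.rvar 0 ∧ ∀ a < k,
      ((y (tgt a) - y (src a)) / (x (tgt a) - x (src a)) < 0 →
        2 * s'.rvar 0 ≤ - ((y (tgt a) - y (src a)) / (x (tgt a) - x (src a)))) ∧
      ((y (src a) - y r) / (x (src a) - x r) < 0 →
        2 * s'.rvar 0 ≤ - ((y (src a) - y r) / (x (src a) - x r)))) ?_ ?_ ?_) ?_ ?_
  · simp [*]
  · rintro k s' - ⟨⟨h5, h1, -⟩, -⟩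
    simp [h5, h1]
  · rintro k s' hk ⟨⟨h5, h3, h2, ha, hb, hc, hd⟩, hpos, h⟩
    refine (Prog.wp.runs ?_).mono (by simp [lower]) fun _ h => h
    simp only [lower, Prog.wp, RExp.eval, IExp.eval, BExp.Holds, State.setI_ivar, State.setI_rvar,
      State.setI_iarr, State.setI_rarr, State.setR_ivar, State.setR_rvar, State.setR_iarr,
      State.setR_rarr, h5, h3, h2, ha, hb, hc, hd]
    set p := (y (tgt k) - y (src k)) / (x (tgt k) - x (src k))
    set q := (y (src k) - y r) / (x (src k) - x r)
    -- Each branch ends with a factor no larger than the old one, so the constraints of earlier arcs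
    -- survive.
    have fin : ∀ ε : ℝ, 0 < ε → ε ≤ s'.rvar 0 → (p < 0 → 2 * ε ≤ - p) → (q < 0 → 2 * ε ≤ - q) →
        0 < ε ∧ ∀ a < k + 1,
      ((y (tgt a) - y (src a)) / (x (tgt a) - x (src a)) < 0 →
        2 * ε ≤ - ((y (tgt a) - y (src a)) / (x (tgt a) - x (src a)))) ∧
      ((y (src a) - y r) / (x (src a) - x r) < 0 →
        2 * ε ≤ - ((y (src a) - y r) / (x (src a) - x r))) := by
      intro ε h1 h2 h3 h4
      refine ⟨h1, fun a ha => ?_⟩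
      rcases Nat.lt_succ_iff_lt_or_eq.1 ha with ha | rfl
      · exact ⟨fun h' => by linarith [(h a ha).1 h'], fun h' => by linarith [(h a ha).2 h']⟩
      · exact ⟨h3, h4⟩
    simp +decide only [↓reduceIte, Rat.cast_zero, show ((-1 / 2 : ℚ) : ℝ) = -1 / 2 by norm_num]
    have hkW : k + 1 ≤ W := by omega
    refine ⟨fun ⟨h1, h2⟩ => ⟨fun ⟨h3, h4⟩ => ⟨hkW, trivial, fin _ ?_ ?_ ?_ ?_⟩,
      fun h3 => ⟨hkW, trivial, fin _ ?_ ?_ ?_ ?_⟩⟩, fun h1 => ⟨fun ⟨h3, h4⟩ =>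
      ⟨hkW, trivial, fin _ ?_ ?_ ?_ ?_⟩, fun h3 => ⟨hkW, trivial, fin _ ?_ ?_ ?_ ?_⟩⟩⟩
    all_goals first
      | linarith
      | (intro h'
         first
          | linarith
          | (by_contra hc; exact h1 ⟨h', by linarith⟩)
          | (by_contra hc; exact h3 ⟨h', by linarith⟩))
  · simp
    omega
  · rintro s' ⟨-, h⟩
    exact h

/-- A vertical difference is unchanged by the shear. Otherwise the slope grows by `δ`: a nonnegative
slope becomes positive, and a negative one, being at most `-2 * δ`, stays negative. -/
theorem shear_ne_zero {dx dy δ : ℝ} (hne : dx ≠ 0 ∨ dy ≠ 0) (hδ : 0 < δ)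
    (h : dy / dx < 0 → 2 * δ ≤ - (dy / dx)) : dy + δ * dx ≠ 0 := by
  by_cases hdx : dx = 0
  · simpa [hdx] using hne
  · rw [show dy + δ * dx = dx * (dy / dx + δ) by field_simp]
    refine mul_ne_zero hdx ?_
    rcases lt_or_ge (dy / dx) 0 with h' | h'
    · linarith [h h']
    · linarith

/-- Shears the points. -/
def shear : Prog :=
  .seq (.setI 5 (.const 0))
  (.loop (.ilt (.var 5) (.var 0))
    (.seq (.storeR 1 (.var 5) (.add (.get 1 (.var 5)) (.mul (.var 0) (.get 0 (.var 5)))))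
    (.setI 5 (.add (.var 5) (.const 1)))))

theorem runs_shear {W : ℕ} {s : State} {n : ℕ} (hn : s.ivar 0 = n) (hW : n ≤ W) :
    Runs W shear s (200 * (n + 1)) fun s' =>
      ∀ i < n, s'.rarr 1 i = s.rarr 1 i + s.rvar 0 * s.rarr 0 i := by
  -- The array is overwritten in place, so the invariant also records that the rest of it is
  -- untouched.
  refine Runs.mono (Runs.for_loop (N := n) (c := 100) (fun k s' => (s'.ivar 5 = k ∧ s'.ivar 0 = n ∧
    s'.rvar 0 = s.rvar 0 ∧ s'.rarr 0 = s.rarr 0) ∧ (∀ i < k, s'.rarr 1 i = s.rarr 1 i +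
      s.rvar 0 * s.rarr 0 i) ∧ ∀ i, k ≤ i → s'.rarr 1 i = s.rarr 1 i) ?_ ?_ ?_) ?_ ?_
  · simp [*]
  · rintro k s' - ⟨⟨h5, h1, -⟩, -⟩
    simp [h5, h1]
  · rintro k s' hk ⟨⟨h5, h0, hv, ha⟩, h, h'⟩
    refine (Prog.wp.runs ?_).mono (by simp) fun _ h => h
    simp [h5, h0, hv, ha]
    refine ⟨by omega, by omega, fun i hi => ?_, fun i hi => ?_⟩
    · rcases hi.lt_or_eq with hi | rfl
      · simp [hi.ne, h i hi]
      · simp [h' i le_rfl]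
    · simp [show i ≠ k by omega, h' i (by omega)]
  · simp
    omega
  · rintro s' ⟨-, h, -⟩
    exact h

/-- Initializes the counters: the root supports itself. -/
def clearCounts : Prog :=
  .seq (.seq (.setI 5 (.const 0))
  (.loop (.ilt (.var 5) (.var 0))
    (.seq (.storeI 7 (.var 5) (.const 0)) (.setI 5 (.add (.var 5) (.const 1))))))
  (.storeI 7 (.var 2) (.const 1))

theorem runs_clearCounts {W : ℕ} {s : State} {n r : ℕ} (hn : s.ivar 0 = n) (hr : s.ivar 2 = r)
    (hrn : r < n) (hW : n ≤ W) :
    Runs W clearCounts s (200 * (n + 1)) fun s' =>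
      ∀ v < n, s'.iarr 7 v = if v = r then 1 else 0 := by
  refine Runs.mono (Runs.seq (T' := 3)
    (Q' := fun s' => ∀ v < n, s'.iarr 7 v = if v = r then 1 else 0) (Runs.for_loop (N := n) (c := 100) (fun k s' =>
    (s'.ivar 5 = k ∧ s'.ivar 0 = n ∧ s'.ivar 2 = r) ∧ ∀ i < k, s'.iarr 7 i = 0) ?_ ?_ ?_) ?_) ?_ ?_
  · simp [*]
  · rintro k s' - ⟨⟨h5, h1, -⟩, -⟩
    simp [h5, h1]
  · rintro k s' hk ⟨⟨h5, h0, hv⟩, h⟩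
    refine (Prog.wp.runs ?_).mono (by simp) fun _ h => h
    simp [h5, h0, hv]
    refine ⟨by omega, by omega, fun i hi => ?_⟩
    rcases hi.lt_or_eq with hi | rfl
    · simp [Function.update_apply, h i hi]
    · simp
  · rintro s' ⟨⟨h5, h0, hv⟩, h⟩
    refine (Prog.wp.runs ?_).mono (by simp) fun _ h => h
    simp [hv]
    refine ⟨by omega, fun v hv => ?_⟩
    simp [Function.update_apply, h v hv]
  · simp
    omega
  · exact fun _ h => h

end RealRAM

/-! ### Event times and initial counters -/

namespace RealRAM

/-- Computes the times of the arc `ivar 5`, and its initial weight in `ivar 13`. -/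
def arcTimes : Prog :=
  .seq (.setI 6 (.get 5 (.var 5)))
  (.seq (.setI 7 (.get 6 (.var 5)))
  (.seq (.setR 1 (.div (.sub (.get 0 (.var 6)) (.get 0 (.var 7)))
    (.sub (.get 1 (.var 7)) (.get 1 (.var 6)))))
  (.ite (.or (.ieq (.var 6) (.var 2)) (.ieq (.var 7) (.var 2)))
    (.seq (.setR 2 (.var 1)) (.seq (.setR 3 (.var 1)) (.setI 13 (.const 1))))
    (.seq (.setR 4 (.div (.sub (.get 0 (.var 2)) (.get 0 (.var 6)))
      (.sub (.get 1 (.var 6)) (.get 1 (.var 2)))))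
    (.ite (.rlt (.mul (.sub (.get 1 (.var 6)) (.get 1 (.var 2)))
        (.sub (.get 1 (.var 7)) (.get 1 (.var 6)))) (.const 0))
      (.seq (.setI 13 (.const 0))
        (.ite (.rlt (.var 4) (.var 1))
          (.seq (.setR 2 (.var 4)) (.setR 3 (.var 1)))
          (.seq (.setR 2 (.var 1)) (.setR 3 (.var 4)))))
      (.seq (.setI 13 (.const 1))
        (.ite (.rlt (.var 4) (.var 1))
          (.seq (.setR 2 (.var 1)) (.setR 3 (.var 4)))
          (.seq (.setR 2 (.var 4)) (.setR 3 (.var 1))))))))))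

theorem runs_arcTimes {W : ℕ} {s : State} {r u v : ℕ} {X Y : ℕ → ℝ} (hr : s.ivar 2 = r)
    (hu : s.iarr 5 (s.ivar 5) = u) (hv : s.iarr 6 (s.ivar 5) = v) (hX : s.rarr 0 = X)
    (hY : s.rarr 1 = Y) (hW : u + v + 1 ≤ W) :
    Runs W arcTimes s 100 fun s' => (s'.ivar 6 = u ∧ s'.ivar 7 = v ∧
      s'.ivar 13 = initWeight Y r u v ∧ s'.rvar 1 = tieTime X Y u v ∧
      s'.rvar 2 = actTime X Y r u v ∧ s'.rvar 3 = deactTime X Y r u v) ∧ Frame arcTimes s s' := by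
  refine Runs.frame (Runs.mono (Prog.wp.runs ?_) (by simp [arcTimes]) fun _ h => h)
  simp only [arcTimes, Prog.wp, RExp.eval, IExp.eval, BExp.Holds, State.setI_ivar, State.setI_rvar,
      State.setI_iarr, State.setI_rarr, State.setR_ivar, State.setR_rvar, State.setR_rarr,
    hu, hX, hY, hr]
  simp +decide only [↓reduceIte, Rat.cast_zero, hv, true_and]
  refine ⟨by omega, by omega, fun h => ⟨by omega, ?_⟩, fun h => ⟨fun h' => ⟨by omega,
    fun h'' => ?_, fun h'' => ?_⟩, fun h' => ⟨by omega, fun h'' => ?_, fun h'' => ?_⟩⟩⟩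
  · simp only [initWeight, actTime, deactTime, if_pos h]
    simp [tieTime]
  all_goals
    simp only [initWeight, actTime, deactTime, if_neg h]
    simp only [tieTime, h', if_true, if_false, true_and]
  · simp [min_eq_left h''.le, max_eq_right h''.le]
  · simp [min_eq_right (not_lt.1 h''), max_eq_left (not_lt.1 h'')]
  · simp [min_eq_left h''.le, max_eq_right h''.le]
  · simp [min_eq_right (not_lt.1 h''), max_eq_left (not_lt.1 h'')]

/-- The times of the events: the event `p * N + a` is the activation (`p = 0`), the tie
(`p = 1`, `p = 2`), or the deactivation (`p = 3`) of the arc `a`. -/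
def IsKey (X Y : ℕ → ℝ) (r N : ℕ) (src tgt : ℕ → ℕ) (key : ℕ → ℝ) (a : ℕ) : Prop :=
  key a = actTime X Y r (src a) (tgt a) ∧ key (N + a) = tieTime X Y (src a) (tgt a) ∧
    key (2 * N + a) = tieTime X Y (src a) (tgt a) ∧
    key (3 * N + a) = deactTime X Y r (src a) (tgt a)

/-- Computes the times of all events, and the initial counters. -/
def computeKeys : Prog :=
  .seq (.setI 5 (.const 0))
  (.loop (.ilt (.var 5) (.var 3))
    (.seq arcTimes
    (.seq (.storeR 2 (.var 5) (.var 2))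
    (.seq (.storeR 2 (.add (.var 3) (.var 5)) (.var 1))
    (.seq (.storeR 2 (.add (.mul (.const 2) (.var 3)) (.var 5)) (.var 1))
    (.seq (.storeR 2 (.add (.mul (.const 3) (.var 3)) (.var 5)) (.var 3))
    (.seq (.storeI 7 (.var 7) (.add (.get 7 (.var 7)) (.var 13)))
    (.setI 5 (.add (.var 5) (.const 1))))))))))

/-- The number of supporters of `v` at the very beginning, in the first `k` arcs. -/
noncomputable def initCount (Y : ℕ → ℝ) (r k : ℕ) (src tgt : ℕ → ℕ) (v : ℕ) : ℕ :=
  (if v = r then 1 else 0) + ∑ a ∈ Finset.range k with tgt a = v, initWeight Y r (src a) (tgt a)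

theorem initWeight_le_one {Y : ℕ → ℝ} {r u v : ℕ} : initWeight Y r u v ≤ 1 := by
  rw [initWeight]
  split_ifs <;> omega

theorem initCount_le {Y : ℕ → ℝ} {r k : ℕ} {src tgt : ℕ → ℕ} {v : ℕ} :
    initCount Y r k src tgt v ≤ 1 + k := by
  refine Nat.add_le_add (by split_ifs <;> omega) ((Finset.sum_le_card_nsmul _ _ 1 fun a _ =>
    initWeight_le_one).trans ?_)
  simpa using Finset.card_filter_le (Finset.range k) fun a => tgt a = v

theorem initCount_succ {Y : ℕ → ℝ} {r k : ℕ} {src tgt : ℕ → ℕ} {v : ℕ} :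
    initCount Y r (k + 1) src tgt v = initCount Y r k src tgt v +
      if tgt k = v then initWeight Y r (src k) (tgt k) else 0 := by
  rw [initCount, initCount, Finset.range_add_one, Finset.filter_insert]
  split_ifs <;> simp_all <;> ring

theorem runs_computeKeys {W : ℕ} {s : State} {n N r : ℕ} {src tgt : ℕ → ℕ} {X Y : ℕ → ℝ}
    (hN : s.ivar 3 = N) (hr : s.ivar 2 = r) (hW : 2 * n + 4 * N + 8 ≤ W) (hsrc : s.iarr 5 = src)
    (htgt : s.iarr 6 = tgt) (hX : s.rarr 0 = X) (hY : s.rarr 1 = Y)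
    (hs : ∀ a < N, src a < n) (ht : ∀ a < N, tgt a < n)
    (hc : ∀ v < n, s.iarr 7 v = if v = r then 1 else 0) :
    Runs W computeKeys s (400 * (N + 1)) fun s' =>
      (∀ a < N, IsKey X Y r N src tgt (s'.rarr 2) a) ∧
      ∀ v < n, s'.iarr 7 v = initCount Y r N src tgt v := by
  refine Runs.mono (Runs.for_loop (N := N) (c := 300) (fun k s' => (s'.ivar 5 = k ∧ s'.ivar 3 = N ∧
    s'.ivar 2 = r ∧ s'.iarr 5 = src ∧ s'.iarr 6 = tgt ∧ s'.rarr 0 = X ∧ s'.rarr 1 = Y) ∧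
      (∀ a < k, IsKey X Y r N src tgt (s'.rarr 2) a) ∧
      ∀ v < n, s'.iarr 7 v = initCount Y r k src tgt v) ?_ ?_ ?_) ?_ ?_
  · simp [*]
    intro v hv
    simp [hc v hv, initCount]
  · rintro k s' - ⟨⟨h5, h1, -⟩, -⟩
    simp [h5, h1]
  · rintro k s' hk ⟨⟨h5, h3, h2, ha, hb, hc, hd⟩, hkey, hcnt⟩
    have hsk := hs k hk
    have htk := ht k hk
    refine Runs.mono (Runs.seq (T' := 100) (runs_arcTimes (u := src k) (v := tgt k) h2
      (by rw [ha, h5]) (by rw [hb, h5]) hc hd (by omega)) fun s'' h => (Prog.wp.runs ?_).mono (by simp) fun _ h => h) (by simp)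
      fun _ h => h
    obtain ⟨⟨e6, e7, e13, e1, e2, e3⟩, hfr⟩ := h
    have f5 := hfr.ivar 5 (by simp [arcTimes, Prog.WritesI])
    have f3 := hfr.ivar 3 (by simp [arcTimes, Prog.WritesI])
    have f2 := hfr.ivar 2 (by simp [arcTimes, Prog.WritesI])
    have fi := fun a => hfr.iarr a (by simp [arcTimes, Prog.StoresI])
    have fr := fun a => hfr.rarr a (by simp [arcTimes, Prog.StoresR])
    have hw := initWeight_le_one (Y := Y) (r := r) (u := src k) (v := tgt k)
    have hcl := initCount_le (Y := Y) (r := r) (k := k) (src := src) (tgt := tgt) (v := tgt k)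
    have hct := hcnt _ htk
    simp [e7, e13, e1, e2, e3, f5, f3, f2, fi, fr, h5, h3, h2, ha, hb, hc, hd]
    refine ⟨by omega, by omega, by omega, by omega, ⟨by omega, by omega⟩, by omega,
      fun a hak => ?_, fun v hv => ?_⟩
    · rcases hak.lt_or_eq with hak | rfl
      -- The four blocks of length `N` are disjoint, so the keys written for arc `k` leave those of
      -- arc `a` alone.
      · simpa [IsKey, Function.update_apply, show a ≠ N + k by omega, show a ≠ 2 * N + k by omega,
          show a ≠ 3 * N + k by omega, show N + a ≠ k by omega, show N + a ≠ 2 * N + k by omega,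
          show N + a ≠ 3 * N + k by omega, show 2 * N + a ≠ N + k by omega,
          show 2 * N + a ≠ k by omega, show 2 * N + a ≠ 3 * N + k by omega,
          show 3 * N + a ≠ N + k by omega, show 3 * N + a ≠ k by omega,
          show 3 * N + a ≠ 2 * N + k by omega, hak.ne] using hkey a hak
      · simp [IsKey, show N ≠ 0 by omega, show N ≠ 2 * N by omega, show N ≠ 3 * N by omega]
    · rw [initCount_succ, Function.update_apply]
      split_ifs with h1 h2 h2
      · rw [h1, hct]
      · exact absurd h1.symm h2
      · exact absurd h2.symm h1
      · rw [hcnt v hv, add_zero]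
  · simp
    omega
  · rintro s' ⟨-, h⟩
    exact h

/-- Counts the vertices without supporters. -/
def countUnsupported : Prog :=
  .seq (.seq (.setI 8 (.const 0)) (.setI 5 (.const 0)))
  (.loop (.ilt (.var 5) (.var 0))
    (.seq (.ite (.ieq (.get 7 (.var 5)) (.const 0)) (.setI 8 (.add (.var 8) (.const 1))) .skip)
    (.setI 5 (.add (.var 5) (.const 1)))))

theorem runs_countUnsupported {W : ℕ} {s : State} {n : ℕ} (hn : s.ivar 0 = n) (hW : n ≤ W) :
    Runs W countUnsupported s (200 * (n + 1)) fun s' =>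
      s'.ivar 8 = ((Finset.range n).filter fun v => s.iarr 7 v = 0).card := by
  refine Runs.mono (Runs.for_loop (N := n) (c := 100) (fun k s' => (s'.ivar 5 = k ∧ s'.ivar 0 = n ∧
    s'.iarr 7 = s.iarr 7) ∧ s'.ivar 8 = ((Finset.range k).filter fun v => s.iarr 7 v = 0).card)
    ?_ ?_ ?_) ?_ ?_
  · simp [*]
  · rintro k s' - ⟨⟨h5, h1, -⟩, -⟩
    simp [h5, h1]
  · rintro k s' hk ⟨⟨h5, h0, h7⟩, h⟩
    refine (Prog.wp.runs ?_).mono (by simp) fun _ h => h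
    have hle := (Finset.card_filter_le (Finset.range k) fun v => s.iarr 7 v = 0)
    rw [Finset.card_range] at hle
    simp [h5, h0, h7, h, Finset.range_add_one, Finset.filter_insert]
    refine ⟨fun h' => ⟨by omega, by omega, by simp [h']⟩, fun h' => ⟨by omega, by simp [h']⟩⟩
  · simp
    omega
  · rintro s' ⟨-, h⟩
    exact h

end RealRAM

namespace RealRAM

/-! ### Sorting with a tournament tree -/

/-- The rank of the element `e`; the non-element `M` comes last. -/
noncomputable def rank (key : ℕ → ℝ) (M e : ℕ) : WithTop (ℝ ×ₗ ℕ) :=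
  if e = M then ⊤ else ((toLex (key e, e) : ℝ ×ₗ ℕ) : WithTop (ℝ ×ₗ ℕ))

/-- Ties in time are broken by the event number. With events numbered `p * N + a`, this puts
activations before marks, marks before checks, and checks before deactivations. -/
theorem rank_lt_rank {key : ℕ → ℝ} {M a b : ℕ} (ha : a < M) (hb : b < M) :
    rank key M a < rank key M b ↔ key a < key b ∨ key a = key b ∧ a < b := by
  rw [rank, rank, if_neg ha.ne, if_neg hb.ne, WithTop.coe_lt_coe, Prod.Lex.toLex_lt_toLex]

theorem rank_injOn {key : ℕ → ℝ} {M a b : ℕ} (ha : a < M) (hb : b < M)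
    (h : rank key M a = rank key M b) : a = b := by
  rw [rank, rank, if_neg ha.ne, if_neg hb.ne, WithTop.coe_inj] at h
  exact (Prod.ext_iff.1 (toLex.injective h)).2

/-- The node `i` holds the smaller one of the entries of its children. -/
def IsNode (key : ℕ → ℝ) (M : ℕ) (T : ℕ → ℕ) (i : ℕ) : Prop :=
  (T i = T (2 * i) ∨ T i = T (2 * i + 1)) ∧ rank key M (T i) ≤ rank key M (T (2 * i)) ∧
    rank key M (T i) ≤ rank key M (T (2 * i + 1))

/-- The leaves `M + e` hold the elements that are not in `D`. -/
def IsLeaf (M : ℕ) (T : ℕ → ℕ) (D : ℕ → Prop) (e : ℕ) : Prop :=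
  D e ∧ T (M + e) = M ∨ ¬ D e ∧ T (M + e) = e

section

variable {key : ℕ → ℝ} {M : ℕ} {T : ℕ → ℕ} {D : ℕ → Prop}

/-- Each inner node copies a child, so its entry comes from a leaf. The layout with leaves `M`, …,
`2 * M - 1` works for every `M`, not only for powers of two. -/
theorem entry_of_isNode (hT : ∀ i, 1 ≤ i → i < M → IsNode key M T i)
    (hL : ∀ e < M, IsLeaf M T D e) {i : ℕ} (hi : 1 ≤ i) (hi' : i < 2 * M) :
    T i = M ∨ T i < M ∧ ¬ D (T i) := by
  induction hn : 2 * M - i using Nat.strong_induction_on generalizing i with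
  | _ k ih =>
    by_cases hiM : i < M
    · obtain ⟨h | h, -⟩ := hT i hi hiM <;> rw [h]
      · exact ih _ (by omega) (by omega) (by omega) rfl
      · exact ih _ (by omega) (by omega) (by omega) rfl
    · obtain ⟨e, rfl⟩ := Nat.exists_eq_add_of_le (not_lt.1 hiM)
      rcases hL e (by omega) with ⟨-, h⟩ | ⟨h', h⟩ <;> rw [h]
      · exact .inl rfl
      · exact .inr ⟨by omega, h'⟩

/-- Climb from a node to its parent `i / 2`; the rank does not increase. -/
theorem rank_root_le (hT : ∀ i, 1 ≤ i → i < M → IsNode key M T i) {i : ℕ} (hi : 1 ≤ i)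
    (hi' : i < 2 * M) : rank key M (T 1) ≤ rank key M (T i) := by
  induction i using Nat.strong_induction_on with
  | _ i ih =>
    rcases hi.eq_or_lt with rfl | h1
    · exact le_rfl
    · refine (ih (i / 2) (by omega) (by omega) (by omega)).trans ?_
      obtain ⟨-, h2, h3⟩ := hT (i / 2) (by omega) (by omega)
      rcases Nat.mod_two_eq_zero_or_one i with h | h
      · rwa [show 2 * (i / 2) = i by omega] at h2
      · rwa [show 2 * (i / 2) + 1 = i by omega] at h3

/-- A removed leaf holds the sentinel `M` of rank `⊤`, which cannot win while an element remains;
injectivity of ranks makes the minimum strict. -/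
theorem root_spec (hT : ∀ i, 1 ≤ i → i < M → IsNode key M T i)
    (hL : ∀ e < M, IsLeaf M T D e) (hD : ∃ e < M, ¬ D e) :
    T 1 < M ∧ ¬ D (T 1) ∧ ∀ e < M, ¬ D e → e ≠ T 1 → rank key M (T 1) < rank key M e := by
  have hle : ∀ e < M, ¬ D e → rank key M (T 1) ≤ rank key M e := by
    intro e he hDe
    have h := rank_root_le hT (i := M + e) (by omega) (by omega)
    rcases hL e he with ⟨h', -⟩ | ⟨-, h'⟩
    · exact absurd h' hDe
    · rwa [h'] at h
  obtain ⟨e, he, hDe⟩ := hD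
  rcases entry_of_isNode hT hL (i := 1) le_rfl (by omega) with h | ⟨h1, h2⟩
  · have := hle e he hDe
    rw [h, rank, if_pos rfl, rank, if_neg he.ne, top_le_iff] at this
    exact absurd this (WithTop.coe_ne_top)
  · exact ⟨h1, h2, fun e he hDe hne => lt_of_le_of_ne (hle e he hDe) fun h =>
      hne (rank_injOn h1 he h).symm⟩

theorem IsNode.update {i j c : ℕ} (h : IsNode key M T j) (h1 : j ≠ i) (h2 : 2 * j ≠ i)
    (h3 : 2 * j + 1 ≠ i) : IsNode key M (Function.update T i c) j := by
  simpa [IsNode, h1, h2, h3] using h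

theorem IsLeaf.update {i c e : ℕ} (h : IsLeaf M T D e) (hi : i < M) :
    IsLeaf M (Function.update T i c) D e := by
  simpa [IsLeaf, show M + e ≠ i by omega] using h

end

/-- Recomputes the node `ivar 5`. -/
def updateNode : Prog :=
  .seq (.setI 12 (.get 2 (.mul (.const 2) (.var 5))))
  (.seq (.setI 13 (.get 2 (.add (.mul (.const 2) (.var 5)) (.const 1))))
  (.ite (.ieq (.var 12) (.var 4)) (.storeI 2 (.var 5) (.var 13))
  (.ite (.ieq (.var 13) (.var 4)) (.storeI 2 (.var 5) (.var 12))
  (.ite (.or (.rlt (.get 2 (.var 12)) (.get 2 (.var 13)))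
      (.and (.req (.get 2 (.var 12)) (.get 2 (.var 13))) (.ilt (.var 12) (.var 13))))
    (.storeI 2 (.var 5) (.var 12)) (.storeI 2 (.var 5) (.var 13))))))

/-- The sentinel is tested before keys are compared, since the number `M` has no meaningful key. -/
theorem runs_updateNode {W M i : ℕ} {s : State} {T : ℕ → ℕ} {key : ℕ → ℝ} (hM : s.ivar 4 = M)
    (hi : s.ivar 5 = i) (hT : s.iarr 2 = T) (hkey : s.rarr 2 = key) (hi0 : 1 ≤ i) (hiM : i ≤ M)
    (h1 : T (2 * i) ≤ M) (h2 : T (2 * i + 1) ≤ M) (hMW : M ≤ W) :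
    Runs W updateNode s 100 fun s' => (∃ c ≤ M, s'.iarr 2 = Function.update T i c ∧
      IsNode key M (Function.update T i c) i) ∧ Frame updateNode s s' := by
  refine Runs.frame (Runs.mono (Prog.wp.runs ?_) (by simp [updateNode]) fun _ h => h)
  have fin : ∀ c, c = T (2 * i) ∨ c = T (2 * i + 1) →
      rank key M c ≤ rank key M (T (2 * i)) → rank key M c ≤ rank key M (T (2 * i + 1)) →
      ∃ c' ≤ M, Function.update T i c = Function.update T i c' ∧
        IsNode key M (Function.update T i c') i := by
    intro c h3 h4 h5
    refine ⟨c, by omega, rfl, ?_⟩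
    simpa [IsNode, show 2 * i ≠ i by omega, show 2 * i + 1 ≠ i by omega] using ⟨h3, h4, h5⟩
  simp only [updateNode, Prog.wp, RExp.eval, IExp.eval, BExp.Holds, State.setI_ivar,
    State.setI_iarr, State.setI_rarr, State.storeI_iarr, hM, hi, hT, hkey]
  simp +decide only [↓reduceIte]
  set a := T (2 * i)
  set b := T (2 * i + 1)
  refine ⟨by omega, by omega, fun h => ⟨by omega, fin _ (.inr rfl) ?_ le_rfl⟩, fun ha =>
    ⟨fun h => ⟨by omega, fin _ (.inl rfl) le_rfl ?_⟩, fun hb => ⟨fun h =>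
      ⟨by omega, fin _ (.inl rfl) le_rfl ?_⟩, fun h => ⟨by omega, fin _ (.inr rfl) ?_ le_rfl⟩⟩⟩⟩
  · simp [h, rank]
  · simp [h, rank]
  · exact ((rank_lt_rank (by omega) (by omega)).2 h).le
  · exact le_of_not_gt fun h' => h ((rank_lt_rank (by omega) (by omega)).1 h')

/-- Builds the tournament tree. -/
def buildTree : Prog :=
  .seq (.seq (.setI 5 (.const 0))
  (.loop (.ilt (.var 5) (.var 4))
    (.seq (.storeI 2 (.add (.var 4) (.var 5)) (.var 5)) (.setI 5 (.add (.var 5) (.const 1))))))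
  (.seq (.setI 5 (.sub (.var 4) (.const 1)))
  (.loop (.ilt (.const 0) (.var 5))
    (.seq updateNode (.setI 5 (.sub (.var 5) (.const 1))))))

/-- Inner nodes are filled in decreasing order, so the children `2 * i` and `2 * i + 1` are always
ready. -/
theorem runs_buildTree {W M : ℕ} {s : State} {key : ℕ → ℝ} (hM : s.ivar 4 = M)
    (hkey : s.rarr 2 = key) (hMW : 2 * M ≤ W) :
    Runs W buildTree s (400 * (M + 1)) fun s' =>
      (∀ i, 1 ≤ i → i < M → IsNode key M (s'.iarr 2) i) ∧ ∀ e < M, s'.iarr 2 (M + e) = e := by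
  refine Runs.mono (Runs.seq
    (Runs.for_loop (N := M) (c := 100) (fun k s' => (s'.ivar 5 = k ∧ s'.ivar 4 = M ∧
      s'.rarr 2 = key) ∧ ∀ e < k, s'.iarr 2 (M + e) = e) ?_ ?_ ?_)
    fun s' hs' => Runs.for_loop (N := M - 1) (c := 150) (fun k s' => (s'.ivar 5 = M - 1 - k ∧
      s'.ivar 4 = M ∧ s'.rarr 2 = key) ∧ (∀ e < M, s'.iarr 2 (M + e) = e) ∧
      (∀ i, M - 1 - k < i → i < M → s'.iarr 2 i ≤ M) ∧
      ∀ i, M - 1 - k < i → i < M → IsNode key M (s'.iarr 2) i) ?_ ?_ ?_) ?_ ?_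
  · simp [*]
  · rintro k s' - ⟨⟨h5, h1, -⟩, -⟩
    simp [h5, h1]
  · rintro k s' hk ⟨⟨h5, h4, hkey⟩, h⟩
    refine (Prog.wp.runs ?_).mono (by simp) fun _ h => h
    simp [h5, h4, hkey]
    refine ⟨by omega, by omega, fun i hi => ?_⟩
    rcases hi.lt_or_eq with hi | rfl
    · simp [hi.ne, h i hi]
    · simp
  · obtain ⟨⟨h5, h4, hkey⟩, h⟩ := hs'
    simp [h4, hkey]
    exact ⟨by omega, h, fun i h1 h2 => by omega, fun i h1 h2 => by omega⟩
  · rintro k s' hk ⟨⟨h5, h1, -⟩, -⟩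
    simp [h5]
  · rintro k s' hk ⟨⟨h5, h4, hkey⟩, hl, hle, hn⟩
    have hchild : ∀ i, M - 1 - k < i → i < 2 * M → s'.iarr 2 i ≤ M := by
      intro i h1 h2
      by_cases hi : i < M
      · exact hle i h1 hi
      · obtain ⟨e, rfl⟩ := Nat.exists_eq_add_of_le (not_lt.1 hi)
        rw [hl e (by omega)]
        omega
    refine Runs.mono (Runs.seq (T' := 50) (runs_updateNode h4 h5 rfl hkey (by omega) (by omega)
      (hchild _ (by omega) (by omega)) (hchild _ (by omega) (by omega)) (by omega)) fun s'' h =>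
      (Prog.wp.runs ?_).mono (by simp) fun _ h => h) (by simp) fun _ h => h
    obtain ⟨⟨c, hc, hT, hnode⟩, hfr⟩ := h
    have f5 := hfr.ivar 5 (by simp [updateNode, Prog.WritesI])
    have f4 := hfr.ivar 4 (by simp [updateNode, Prog.WritesI])
    have fr := hfr.rarr 2 (by simp [updateNode, Prog.StoresR])
    simp [f5, f4, fr, h5, h4, hkey, hT]
    refine ⟨by omega, by omega, fun e he => ?_, fun i h1 h2 => ?_, fun i h1 h2 => ?_⟩
    · rw [Function.update_of_ne (by omega), hl e he]
    · rw [Function.update_apply]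
      split_ifs
      · exact hc
      · exact hle i (by omega) h2
    · by_cases hi : i = M - 1 - k
      · rwa [hi]
      · exact (hn i (by omega) h2).update hi (by omega) (by omega)
  · simp
    omega
  · rintro s' ⟨-, hl, -, h⟩
    exact ⟨fun i h1 h2 => h i (by omega) h2, hl⟩

/-- Recomputes the ancestors of a leaf. -/
def updatePath : Prog :=
  .loop (.ilt (.const 0) (.var 5)) (.seq updateNode (.setI 5 (.div (.var 5) (.const 2))))

/-- The invariant tolerates defects only at the current node and its ancestors `i / 2 ^ j`; each
round repairs one node and moves up. The index halves, so `i < 2 ^ f` allows at most `f` rounds. -/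
theorem runs_updatePath {W M f i : ℕ} {s : State} {key : ℕ → ℝ} {D : ℕ → Prop} (hM : s.ivar 4 = M)
    (hkey : s.rarr 2 = key) (hMW : 2 * M ≤ W) (hi : s.ivar 5 = i) (hiM : i < M) (hif : i < 2 ^ f)
    (hle : ∀ l, 1 ≤ l → l < 2 * M → s.iarr 2 l ≤ M) (hL : ∀ e < M, IsLeaf M (s.iarr 2) D e)
    (hT : ∀ l, 1 ≤ l → l < M → IsNode key M (s.iarr 2) l ∨ ∃ j, l = i / 2 ^ j) :
    Runs W updatePath s (200 * (f + 1)) fun s' =>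
      ((∀ i, 1 ≤ i → i < M → IsNode key M (s'.iarr 2) i) ∧ ∀ e < M, IsLeaf M (s'.iarr 2) D e) ∧
        Frame updatePath s s' := by
  refine Runs.frame (Runs.mono (Runs.loop_fuel (c := 150) (fun k s' => (s'.ivar 4 = M ∧
    s'.rarr 2 = key ∧ s'.ivar 5 < M ∧ s'.ivar 5 < 2 ^ k) ∧
    (∀ l, 1 ≤ l → l < 2 * M → s'.iarr 2 l ≤ M) ∧ (∀ e < M, IsLeaf M (s'.iarr 2) D e) ∧
    ∀ l, 1 ≤ l → l < M → IsNode key M (s'.iarr 2) l ∨ ∃ j, l = s'.ivar 5 / 2 ^ j) ?_ f s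
    ⟨⟨hM, hkey, hi ▸ hiM, hi ▸ hif⟩, hle, hL, hi ▸ hT⟩) ?_ ?_)
  · rintro k s' ⟨⟨h4, hkey, h5, h5'⟩, hle, hL, hT⟩ hb
    simp only [BExp.Holds, IExp.eval] at hb
    obtain ⟨k, rfl⟩ : ∃ k', k = k' + 1 := by
      cases k with
      | zero => simp at h5'; omega
      | succ k => exact ⟨k, rfl⟩
    refine ⟨k, rfl, Runs.mono (Runs.seq (T' := 50) (runs_updateNode h4 rfl rfl hkey hb h5.le
      (hle _ (by omega) (by omega)) (hle _ (by omega) (by omega)) (by omega)) fun s'' h =>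
      (Prog.wp.runs ?_).mono (by simp) fun _ h => h) (by simp) fun _ h => h⟩
    obtain ⟨⟨c, hc, hT', hnode⟩, hfr⟩ := h
    have f5 := hfr.ivar 5 (by simp [updateNode, Prog.WritesI])
    have f4 := hfr.ivar 4 (by simp [updateNode, Prog.WritesI])
    have fr := hfr.rarr 2 (by simp [updateNode, Prog.StoresR])
    simp [f5, f4, fr, h4, hkey, hT']
    refine ⟨by omega, ⟨by omega, by rw [pow_succ] at h5'; omega⟩, fun l h1 h2 => ?_,
      fun e he => (hL e he).update h5, fun l h1 h2 => ?_⟩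
    · rw [Function.update_apply]
      split_ifs
      · exact hc
      · exact hle l h1 h2
    · by_cases hl : l = s'.ivar 5
      · exact .inl (hl ▸ hnode)
      by_cases hl2 : l = s'.ivar 5 / 2
      · exact .inr ⟨0, by simpa using hl2⟩
      rcases hT l h1 h2 with h | ⟨j, hj⟩
      · exact .inl (h.update hl (by omega) (by omega))
      · refine .inr ⟨j - 1, ?_⟩
        cases j with
        | zero => simp at hj; exact absurd hj hl
        | succ j => rw [hj, pow_succ', Nat.div_div_eq_div_mul, Nat.add_sub_cancel]
  · simp
    omega
  · rintro s' ⟨⟨j, -, -, hL, hT⟩, hb⟩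
    simp only [BExp.Holds, IExp.eval, not_lt, Nat.le_zero] at hb
    refine ⟨fun l h1 h2 => (hT l h1 h2).resolve_right ?_, hL⟩
    rintro ⟨j, hj⟩
    rw [hb, Nat.zero_div] at hj
    omega

end RealRAM

/-! ### Extraction in sorted order -/

namespace RealRAM

/-- The sequence `o` lists the numbers below `M` in increasing order of their ranks. -/
structure IsSorted (key : ℕ → ℝ) (M : ℕ) (o : ℕ → ℕ) : Prop where
  lt : ∀ k < M, o k < M
  rank_lt : ∀ l k, l < k → k < M → rank key M (o l) < rank key M (o k)

/-- Repeatedly removes the first element from the tournament tree. -/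
def extractAll : Prog :=
  .seq (.setI 10 (.const 0))
  (.loop (.ilt (.var 10) (.var 4))
    (.seq (.seq (.setI 11 (.get 2 (.const 1)))
      (.seq (.storeI 4 (.var 10) (.var 11))
      (.seq (.storeI 2 (.add (.var 4) (.var 11)) (.var 4))
      (.setI 5 (.div (.add (.var 4) (.var 11)) (.const 2))))))
    (.seq updatePath (.setI 10 (.add (.var 10) (.const 1))))))

/-- By pigeonhole, some element is still in the tournament after `k` removals. -/
theorem exists_lt_forall_ne {k M : ℕ} (hk : k < M) (o : ℕ → ℕ) :
    ∃ e < M, ¬ ∃ l < k, o l = e := by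
  obtain ⟨e, he, he'⟩ := Finset.exists_mem_notMem_of_card_lt_card
    (s := (Finset.range k).image o) (t := Finset.range M)
    (lt_of_le_of_lt Finset.card_image_le (by simpa using hk))
  exact ⟨e, Finset.mem_range.1 he, by simpa using he'⟩

theorem runs_extractAll {W M f : ℕ} {s : State} {key : ℕ → ℝ} (hM : s.ivar 4 = M)
    (hkey : s.rarr 2 = key) (hMW : 2 * M ≤ W) (hf : M ≤ 2 ^ f)
    (hT : ∀ i, 1 ≤ i → i < M → IsNode key M (s.iarr 2) i) (hL : ∀ e < M, s.iarr 2 (M + e) = e) :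
    Runs W extractAll s (400 * (M + 1) * (f + 1)) fun s' => IsSorted key M (s'.iarr 4) := by
  refine Runs.mono (Runs.for_loop (N := M) (c := 100 + (200 * (f + 1) + 50))
    (fun k s' => (s'.ivar 10 = k ∧ s'.ivar 4 = M ∧ s'.rarr 2 = key) ∧
      ((∀ i, 1 ≤ i → i < M → IsNode key M (s'.iarr 2) i) ∧
        ∀ e < M, IsLeaf M (s'.iarr 2) (fun e => ∃ l < k, s'.iarr 4 l = e) e) ∧
      (∀ l < k, s'.iarr 4 l < M) ∧
      (∀ j l, j < l → l < k → rank key M (s'.iarr 4 j) < rank key M (s'.iarr 4 l)) ∧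
      ∀ l < k, ∀ e < M, (¬ ∃ l < k, s'.iarr 4 l = e) →
        rank key M (s'.iarr 4 l) < rank key M e) ?_ ?_ ?_) ?_ ?_
  · simp [*]
    exact ⟨hT, fun e he => Or.inr ⟨not_false, hL e he⟩⟩
  · rintro k s' - ⟨⟨h5, h1, -⟩, -⟩
    simp [h5, h1]
  · rintro k s' hk ⟨⟨h10, h4, hkey⟩, ⟨hT, hL⟩, hlt, hsort, hrest⟩
    obtain ⟨hr1, hr2, hr3⟩ := root_spec hT hL (exists_lt_forall_ne hk _)
    have hentry := fun i h1 h2 => entry_of_isNode hT hL (i := i) h1 h2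
    set o := s'.iarr 4 with ho
    set T := s'.iarr 2 with hTdef
    set e := T 1 with he
    have hmem : ∀ x, (∃ l < k + 1, Function.update o k e l = x) ↔ (∃ l < k, o l = x) ∨ x = e := by
      intro x
      constructor
      · rintro ⟨l, hl, rfl⟩
        rcases Nat.lt_succ_iff_lt_or_eq.1 hl with hl | rfl
        · exact .inl ⟨l, hl, by rw [Function.update_of_ne hl.ne]⟩
        · exact .inr (Function.update_self ..)
      · rintro (⟨l, hl, rfl⟩ | rfl)
        · exact ⟨l, by omega, by rw [Function.update_of_ne hl.ne]⟩
        · exact ⟨k, by omega, Function.update_self ..⟩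
    refine Runs.mono (Runs.seq (Runs.frame (Q := fun s'' => s''.iarr 4 = Function.update o k e ∧
      s''.iarr 2 = Function.update T (M + e) M ∧ s''.ivar 5 = (M + e) / 2) (Prog.wp.runs ?_))
      fun s1 h1 => Runs.seq (T' := 50) (runs_updatePath (M := M) (f := f) (i := (M + e) / 2)
        (D := fun x => (∃ l < k, o l = x) ∨ x = e) (key := key)
        ?_ ?_ hMW h1.1.2.2 (by omega) (by omega) ?_ ?_ ?_)
      fun s2 h2 => (Prog.wp.runs ?_).mono (by simp) fun _ h => h)
      (by simp) fun _ h => h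
    · simp [h10, h4, ← ho, ← he, ← hTdef]
      omega
    · rw [h1.2.ivar 4 (by simp [Prog.WritesI]), h4]
    · rw [h1.2.rarr 2 (by simp [Prog.StoresR]), hkey]
    · intro l hl1 hl2
      rw [h1.1.2.1, Function.update_apply]
      split_ifs
      · exact le_rfl
      · rcases hentry l hl1 hl2 with h | h <;> omega
    · intro x hx
      rw [h1.1.2.1]
      by_cases hxe : x = e
      · exact .inl ⟨.inr hxe, by rw [hxe, Function.update_self]⟩
      · rw [IsLeaf, Function.update_of_ne (by omega)]
        rcases hL x hx with ⟨h, h'⟩ | ⟨h, h'⟩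
        · exact .inl ⟨.inl h, h'⟩
        · exact .inr ⟨not_or.2 ⟨h, hxe⟩, h'⟩
    · intro l hl1 hl2
      rw [h1.1.2.1]
      -- Only the parent of the overwritten leaf has a changed child.
      by_cases hl : l = (M + e) / 2
      · exact .inr ⟨0, by simpa using hl⟩
      · exact .inl ((hT l hl1 hl2).update (by omega) (by omega) (by omega))
    · obtain ⟨⟨g4, g2, g5⟩, fr1⟩ := h1
      obtain ⟨⟨hT2, hL2⟩, fr2⟩ := h2
      have f10 := (fr2.ivar 10 (by simp [updatePath, updateNode, Prog.WritesI])).trans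
        (fr1.ivar 10 (by simp [Prog.WritesI]))
      have f4 := (fr2.ivar 4 (by simp [updatePath, updateNode, Prog.WritesI])).trans
        (fr1.ivar 4 (by simp [Prog.WritesI]))
      have fr := (fr2.rarr 2 (by simp [updatePath, updateNode, Prog.StoresR])).trans
        (fr1.rarr 2 (by simp [Prog.StoresR]))
      have fo := (fr2.iarr 4 (by simp [updatePath, updateNode, Prog.StoresI])).trans g4
      simp only [Prog.wp, IExp.eval, f10, h10]
      refine ⟨by omega, ?_⟩
      simp only [State.setI_ivar, State.setI_iarr, State.setI_rarr, fo, fr, f4, h4, hkey]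
      refine ⟨by simp, ⟨hT2, ?_⟩, ?_, ?_, ?_⟩
      · simpa only [hmem] using hL2
      · intro l hl
        rw [Function.update_apply]
        split_ifs with h
        · exact hr1
        · exact hlt l (by omega)
      · intro j l hjl hl
        rw [Function.update_of_ne (by omega)]
        rcases Nat.lt_succ_iff_lt_or_eq.1 hl with hl | rfl
        · rw [Function.update_of_ne hl.ne]
          exact hsort j l hjl hl
        · rw [Function.update_self]
          exact hrest j hjl e hr1 hr2
      · intro l hl x hx hxn
        rw [hmem, not_or] at hxn
        rw [Function.update_apply]
        split_ifs with h
        · exact hr3 x hx hxn.1 hxn.2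
        · exact hrest l (by omega) x hx hxn.1
  · simp only [Prog.bound, IExp.cost, BExp.cost]
    ring_nf
    generalize M * f = x
    omega
  · rintro s' ⟨-, -, h1, h2, -⟩
    exact ⟨h1, h2⟩

/-- Sorts the events. -/
def sort : Prog := .seq buildTree extractAll

theorem runs_sort {W M f : ℕ} {s : State} {key : ℕ → ℝ} (hM : s.ivar 4 = M)
    (hkey : s.rarr 2 = key) (hMW : 2 * M ≤ W) (hf : M ≤ 2 ^ f) :
    Runs W sort s (800 * (M + 1) * (f + 1)) fun s' => IsSorted key M (s'.iarr 4) := by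
  refine Runs.mono (Runs.seq (runs_buildTree hM hkey hMW).frame fun s' h =>
    runs_extractAll (f := f) ?_ ?_ hMW hf h.1.1 h.1.2) ?_ fun _ h => h
  · rw [h.2.ivar 4 (by simp [buildTree, updateNode, Prog.WritesI]), hM]
  · rw [h.2.rarr 2 (by simp [buildTree, updateNode, Prog.StoresR]), hkey]
  · ring_nf
    generalize M * f = x
    omega

end RealRAM

namespace RealRAM

/-! ### The sweep -/

/-- Strictly increasing ranks make `o` injective, hence surjective, on the numbers below `M`. -/
theorem IsSorted.exists_eq {key : ℕ → ℝ} {M e : ℕ} {o : ℕ → ℕ} (ho : IsSorted key M o)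
    (he : e < M) : ∃ l < M, o l = e := by
  have hinj : Set.InjOn o (Finset.range M) := by
    intro i hi j hj hij
    simp only [Finset.coe_range, Set.mem_Iio] at hi hj
    rcases lt_trichotomy i j with h | h | h
    · exact absurd (ho.rank_lt i j h hj) (by rw [hij]; exact lt_irrefl _)
    · exact h
    · exact absurd (ho.rank_lt j i h hi) (by rw [hij]; exact lt_irrefl _)
  have himg : (Finset.range M).image o = Finset.range M := by
    refine Finset.eq_of_subset_of_card_le ?_ (by rw [Finset.card_image_of_injOn hinj])
    intro x hx
    obtain ⟨l, hl, rfl⟩ := Finset.mem_image.1 hx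
    exact Finset.mem_range.2 (ho.lt l (Finset.mem_range.1 hl))
  obtain ⟨l, hl, rfl⟩ := Finset.mem_image.1 (himg.symm ▸ Finset.mem_range.2 he)
  exact ⟨l, Finset.mem_range.1 hl, rfl⟩

/-- Translates "already processed" into a comparison of ranks, so that the state of the sweep
depends only on keys and event numbers. -/
theorem IsSorted.done_iff {key : ℕ → ℝ} {M k e : ℕ} {o : ℕ → ℕ} (ho : IsSorted key M o)
    (hk : k < M) (he : e < M) : (∃ l < k, o l = e) ↔ rank key M e < rank key M (o k) := by
  constructor
  · rintro ⟨l, hl, rfl⟩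
    exact ho.rank_lt l k hl hk
  · intro h
    obtain ⟨l, hl, rfl⟩ := ho.exists_eq he
    refine ⟨l, ?_, rfl⟩
    by_contra! hkl
    rcases hkl.eq_or_lt with rfl | hkl
    · exact lt_irrefl _ h
    · exact lt_asymm h (ho.rank_lt k l hkl hl)

open Classical in
/-- The current weight of the arc `a`, after the events in `D`. -/
noncomputable def curWeight (Y : ℕ → ℝ) (r N : ℕ) (src tgt : ℕ → ℕ) (D : ℕ → Prop) (a : ℕ) : ℕ :=
  initWeight Y r (src a) (tgt a) + (if D a then 1 else 0) - (if D (3 * N + a) then 1 else 0)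

/-- The current number of supporters of the vertex `v`, after the events in `D`. -/
noncomputable def curCount (Y : ℕ → ℝ) (r N : ℕ) (src tgt : ℕ → ℕ) (D : ℕ → Prop) (v : ℕ) : ℕ :=
  (if v = r then 1 else 0) + ∑ a ∈ Finset.range N with tgt a = v, curWeight Y r N src tgt D a

/-- At the tie of the arc `b`, its ends are each supported by the other one only. -/
def IsBad (X Y : ℕ → ℝ) (r N : ℕ) (src tgt : ℕ → ℕ) (b : ℕ) : Prop :=
  count X Y r N src tgt (src b) (tieTime X Y (src b) (tgt b)) = 1 ∧
    count X Y r N src tgt (tgt b) (tieTime X Y (src b) (tgt b)) = 1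

/-- What the variables of the program mean, after the events in `D`. -/
structure SweepInv (X Y : ℕ → ℝ) (n r N : ℕ) (src tgt : ℕ → ℕ) (D : ℕ → Prop) (cnt : ℕ → ℕ)
    (F ans bad : ℕ) (last : ℝ) : Prop where
  cnt_eq : ∀ v < n, cnt v = curCount Y r N src tgt D v
  F_eq : F = ((Finset.range n).filter fun v => cnt v = 0).card
  ans_le : ans ≤ 1
  ans_iff : ans = 1 ↔ ∃ a < N, D (2 * N + a) ∧
    Check X Y n r N src tgt (tieTime X Y (src a) (tgt a))
  exists_bad : bad = 1 → ∃ b < N, D (N + b) ∧ IsBad X Y r N src tgt b ∧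
    tieTime X Y (src b) (tgt b) = last
  of_bad : ∀ b < N, D (N + b) → IsBad X Y r N src tgt b →
    bad = 1 ∧ tieTime X Y (src b) (tgt b) ≤ last

/-! ### Effect of one event on the invariant -/

section

variable {X Y key : ℕ → ℝ} {n r N k : ℕ} {src tgt o cnt : ℕ → ℕ} {D : ℕ → Prop} {F ans bad : ℕ}
  {last : ℝ}

theorem curWeight_le : curWeight Y r N src tgt D k ≤ 2 := by
  have := initWeight_le_one (Y := Y) (r := r) (u := src k) (v := tgt k)
  rw [curWeight]
  split_ifs <;> omega

theorem curCount_le {v : ℕ} : curCount Y r N src tgt D v ≤ 1 + 2 * N := by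
  refine Nat.add_le_add (by split_ifs <;> omega) ((Finset.sum_le_card_nsmul _ _ 2 fun a _ =>
    curWeight_le).trans ?_)
  have := Finset.card_filter_le (Finset.range N) fun a => tgt a = v
  rw [Finset.card_range] at this
  rw [smul_eq_mul]
  omega

/-- An arc of initial weight zero is thus activated before it is deactivated, so the truncated
subtraction in its weight never truncates. -/
theorem actTime_le_deactTime {u v : ℕ} (h : initWeight Y r u v = 0) :
    actTime X Y r u v ≤ deactTime X Y r u v := by
  unfold initWeight at h
  unfold actTime deactTime
  by_cases h1 : u = r ∨ v = r
  · simp [h1]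
  · by_cases h2 : (Y u - Y r) * (Y v - Y u) < 0
    · simp only [if_neg h1, if_pos h2]
      exact min_le_max
    · simp [h1, h2] at h

/-- Changing one counter affects the number of zeros only through that entry. The additive form
avoids truncated subtraction. -/
theorem card_filter_eq_zero_add {g g' : ℕ → ℕ} {v : ℕ} (hv : v < n)
    (h : ∀ x < n, x ≠ v → g' x = g x) :
    ((Finset.range n).filter fun x => g' x = 0).card + (if g v = 0 then 1 else 0) =
      ((Finset.range n).filter fun x => g x = 0).card + (if g' v = 0 then 1 else 0) := by
  rw [Finset.card_filter, Finset.card_filter, ← Finset.add_sum_erase _ _ (Finset.mem_range.2 hv),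
    ← Finset.add_sum_erase _ (fun x => if g x = 0 then 1 else 0) (Finset.mem_range.2 hv),
    Finset.sum_congr rfl (g := fun x => if g x = 0 then 1 else 0)]
  · ring
  · intro x hx
    rw [Finset.mem_erase, Finset.mem_range] at hx
    rw [h x hx.2 hx.1]

theorem curCount_congr {D' : ℕ → Prop} {v : ℕ} (h : ∀ b < N, tgt b = v →
    curWeight Y r N src tgt D' b = curWeight Y r N src tgt D b) :
    curCount Y r N src tgt D' v = curCount Y r N src tgt D v := by
  rw [curCount, curCount]
  refine congrArg _ (Finset.sum_congr rfl fun b hb => ?_)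
  rw [Finset.mem_filter, Finset.mem_range] at hb
  exact h b hb.1 hb.2

theorem curCount_add {D' : ℕ → Prop} {a : ℕ} (ha : a < N) (h : ∀ b < N, b ≠ a →
    curWeight Y r N src tgt D' b = curWeight Y r N src tgt D b) :
    curCount Y r N src tgt D' (tgt a) + curWeight Y r N src tgt D a =
      curCount Y r N src tgt D (tgt a) + curWeight Y r N src tgt D' a := by
  have hmem : a ∈ {b ∈ Finset.range N | tgt b = tgt a} := by simp [ha]
  rw [curCount, curCount, ← Finset.add_sum_erase _ _ hmem,
    ← Finset.add_sum_erase _ (curWeight Y r N src tgt D) hmem,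
    Finset.sum_congr rfl (g := curWeight Y r N src tgt D)]
  · ring
  · intro b hb
    rw [Finset.mem_erase, Finset.mem_filter, Finset.mem_range] at hb
    exact h b hb.2.1 hb.1

theorem curWeight_congr {D' : ℕ → Prop} {b : ℕ} (h1 : D' b ↔ D b)
    (h2 : D' (3 * N + b) ↔ D (3 * N + b)) :
    curWeight Y r N src tgt D' b = curWeight Y r N src tgt D b := by
  classical
  rw [curWeight, curWeight, if_congr h1 rfl rfl, if_congr h2 rfl rfl]

/-- The events before the `k`-th one. -/
def Done (o : ℕ → ℕ) (k e : ℕ) : Prop := ∃ l < k, o l = e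

theorem done_succ {e : ℕ} : Done o (k + 1) e ↔ Done o k e ∨ e = o k := by
  constructor
  · rintro ⟨l, hl, rfl⟩
    rcases Nat.lt_succ_iff_lt_or_eq.1 hl with hl | rfl
    · exact .inl ⟨l, hl, rfl⟩
    · exact .inr rfl
  · rintro (⟨l, hl, rfl⟩ | rfl)
    · exact ⟨l, by omega, rfl⟩
    · exact ⟨k, by omega, rfl⟩

theorem IsSorted.done_iff' {M e : ℕ} (ho : IsSorted key M o)
    (hk : k < M) (he : e < M) :
    Done o k e ↔ key e < key (o k) ∨ key e = key (o k) ∧ e < o k := by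
  rw [Done, ho.done_iff hk he, rank_lt_rank he (ho.lt k hk)]

theorem IsSorted.not_done (ho : IsSorted key (4 * N) o) (hk : k < 4 * N) : ¬ Done o k (o k) := by
  rw [ho.done_iff' hk (ho.lt k hk)]
  simp

/-- For marks and checks, whose numbers lie in `[N, 3 * N)`, activations of equal time have smaller
numbers and are done, while deactivations of equal time have larger numbers and are not. This
matches `≤` and `<` in `weight`. -/
theorem curCount_eq_count (hkey : ∀ a < N, IsKey X Y r N src tgt key a)
    (ho : IsSorted key (4 * N) o) (hk : k < 4 * N) (h1 : N ≤ o k) (h2 : o k < 3 * N) (v : ℕ) :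
    curCount Y r N src tgt (Done o k) v = count X Y r N src tgt v (key (o k)) := by
  rw [curCount, count]
  refine congrArg _ (Finset.sum_congr rfl fun b hb => ?_)
  rw [Finset.mem_filter, Finset.mem_range] at hb
  obtain ⟨e1, -, -, e2⟩ := hkey b hb.1
  have d1 : Done o k b ↔ actTime X Y r (src b) (tgt b) ≤ key (o k) := by
    rw [ho.done_iff' hk (by omega), e1, le_iff_lt_or_eq,
      and_iff_left (show b < o k by omega)]
  have d2 : Done o k (3 * N + b) ↔ deactTime X Y r (src b) (tgt b) < key (o k) := by
    rw [ho.done_iff' hk (by omega), e2]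
    simp [show ¬ 3 * N + b < o k by omega]
  simp only [curWeight, weight, d1, d2]

theorem SweepInv.activate (h : SweepInv X Y n r N src tgt (Done o k) cnt F ans bad last)
    (hkey : ∀ a < N, IsKey X Y r N src tgt key a) (ho : IsSorted key (4 * N) o) (hk : k < 4 * N)
    (ht : ∀ a < N, tgt a < n) {a : ℕ} (ha : a < N) (he : o k = a) :
    SweepInv X Y n r N src tgt (Done o (k + 1))
      (Function.update cnt (tgt a) (cnt (tgt a) + 1))
      (if cnt (tgt a) = 0 then F - 1 else F) ans bad last := by
  classical
  have hnot := ho.not_done hk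
  rw [he] at hnot
  have hother : ∀ e, e ≠ a → (Done o (k + 1) e ↔ Done o k e) := by
    intro e hne
    rw [done_succ, he]
    simp [hne]
  have hself : Done o (k + 1) a := done_succ.2 (.inr he.symm)
  have hcong : ∀ b < N, b ≠ a → curWeight Y r N src tgt (Done o (k + 1)) b =
      curWeight Y r N src tgt (Done o k) b := fun b hb hne =>
    curWeight_congr (hother b hne) (hother _ (by omega))
  have hw : curWeight Y r N src tgt (Done o (k + 1)) a =
      curWeight Y r N src tgt (Done o k) a + 1 := by
    have h3 := hother (3 * N + a) (by omega)
    rw [curWeight, curWeight, if_pos hself, if_neg hnot, if_congr h3 rfl rfl]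
    -- If the deactivation came first, the initial weight must be one, so adding one is not
    -- swallowed by truncation.
    by_cases hd : Done o k (3 * N + a)
    · have hi : initWeight Y r (src a) (tgt a) ≠ 0 := by
        intro hi
        have hle := actTime_le_deactTime (X := X) hi
        obtain ⟨e1, -, -, e2⟩ := hkey a ha
        rw [ho.done_iff' hk (by omega), he, e1, e2] at hd
        rcases hd with hd | hd
        · linarith
        · omega
      rw [if_pos hd]
      omega
    · rw [if_neg hd]
      omega
  have hc := curCount_add ha hcong
  rw [hw] at hc
  have hF := card_filter_eq_zero_add (g := cnt)
    (g' := Function.update cnt (tgt a) (cnt (tgt a) + 1)) (ht a ha)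
    fun x _ hx => Function.update_of_ne hx _ _
  rw [← h.F_eq, Function.update_self, if_neg (Nat.succ_ne_zero _)] at hF
  refine ⟨fun v hv => ?_, ?_, h.ans_le, ?_, ?_, ?_⟩
  · by_cases hva : v = tgt a
    · rw [hva, Function.update_self, h.cnt_eq _ (ht a ha)]
      omega
    · rw [Function.update_of_ne hva, h.cnt_eq v hv]
      exact (curCount_congr fun b hb hbv => hcong b hb fun h => hva (by rw [← hbv, h])).symm
  · split_ifs with h0
    · rw [if_pos h0] at hF
      omega
    · rw [if_neg h0] at hF
      omega
  · rw [h.ans_iff]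
    exact exists_congr fun b => and_congr_right fun hb => by rw [hother _ (by omega)]
  · intro hb
    obtain ⟨b, hb, hd, hl⟩ := h.exists_bad hb
    exact ⟨b, hb, (hother _ (by omega)).2 hd, hl⟩
  · intro b hb hd
    exact h.of_bad b hb ((hother _ (by omega)).1 hd)

theorem SweepInv.deactivate (h : SweepInv X Y n r N src tgt (Done o k) cnt F ans bad last)
    (hkey : ∀ a < N, IsKey X Y r N src tgt key a) (ho : IsSorted key (4 * N) o) (hk : k < 4 * N)
    (ht : ∀ a < N, tgt a < n) {a : ℕ} (ha : a < N) (he : o k = 3 * N + a) :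
    SweepInv X Y n r N src tgt (Done o (k + 1))
      (Function.update cnt (tgt a) (cnt (tgt a) - 1))
      (if cnt (tgt a) - 1 = 0 then F + 1 else F) ans bad last := by
  classical
  have hnot := ho.not_done hk
  rw [he] at hnot
  have hother : ∀ e, e ≠ 3 * N + a → (Done o (k + 1) e ↔ Done o k e) := by
    intro e hne
    rw [done_succ, he]
    simp [hne]
  have hself : Done o (k + 1) (3 * N + a) := done_succ.2 (.inr he.symm)
  have hcong : ∀ b < N, b ≠ a → curWeight Y r N src tgt (Done o (k + 1)) b =
      curWeight Y r N src tgt (Done o k) b := fun b hb hne =>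
    curWeight_congr (hother b (by omega)) (hother _ (by omega))
  have hw : curWeight Y r N src tgt (Done o k) a =
      curWeight Y r N src tgt (Done o (k + 1)) a + 1 := by
    have h3 := hother a (by omega)
    rw [curWeight, curWeight, if_pos hself, if_neg hnot, if_congr h3 rfl rfl]
    by_cases hd : Done o k a
    · rw [if_pos hd]
      omega
    -- With initial weight zero the activation would already be done, also at equal times, because
    -- `a < 3 * N + a`.
    · have hi : initWeight Y r (src a) (tgt a) ≠ 0 := by
        intro hi
        have hle := actTime_le_deactTime (X := X) hi
        obtain ⟨e1, -, -, e2⟩ := hkey a ha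
        refine hd ?_
        rw [ho.done_iff' hk (by omega), he, e1, e2]
        rcases hle.lt_or_eq with hle | hle
        · exact .inl hle
        · exact .inr ⟨hle, by omega⟩
      rw [if_neg hd]
      omega
  have hc := curCount_add ha hcong
  rw [hw] at hc
  have hcnt := h.cnt_eq _ (ht a ha)
  have hF := card_filter_eq_zero_add (g := cnt)
    (g' := Function.update cnt (tgt a) (cnt (tgt a) - 1)) (ht a ha)
    fun x _ hx => Function.update_of_ne hx _ _
  rw [← h.F_eq, Function.update_self, if_neg (show cnt (tgt a) ≠ 0 by omega)] at hF
  refine ⟨fun v hv => ?_, ?_, h.ans_le, ?_, ?_, ?_⟩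
  · by_cases hva : v = tgt a
    · rw [hva, Function.update_self, h.cnt_eq _ (ht a ha)]
      omega
    · rw [Function.update_of_ne hva, h.cnt_eq v hv]
      exact (curCount_congr fun b hb hbv => hcong b hb fun h => hva (by rw [← hbv, h])).symm
  · split_ifs with h0
    · rw [if_pos h0] at hF
      omega
    · rw [if_neg h0] at hF
      omega
  · rw [h.ans_iff]
    exact exists_congr fun b => and_congr_right fun hb => by rw [hother _ (by omega)]
  · intro hb
    obtain ⟨b, hb, hd, hl⟩ := h.exists_bad hb
    exact ⟨b, hb, (hother _ (by omega)).2 hd, hl⟩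
  · intro b hb hd
    exact h.of_bad b hb ((hother _ (by omega)).1 hd)

theorem curCount_done_succ (h1 : N ≤ o k) (h2 : o k < 3 * N) (v : ℕ) :
    curCount Y r N src tgt (Done o (k + 1)) v = curCount Y r N src tgt (Done o k) v := by
  have hother : ∀ e, e ≠ o k → (Done o (k + 1) e ↔ Done o k e) := by
    intro e hne
    rw [done_succ]
    simp [hne]
  exact curCount_congr fun b hb _ => curWeight_congr (hother _ (by omega)) (hother _ (by omega))

-- Events come in order of time, so the newest bad tie is the latest one and `last` may simply be
-- overwritten.
open Classical in
theorem SweepInv.mark (h : SweepInv X Y n r N src tgt (Done o k) cnt F ans bad last)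
    (hkey : ∀ a < N, IsKey X Y r N src tgt key a) (ho : IsSorted key (4 * N) o) (hk : k < 4 * N)
    (hs : ∀ a < N, src a < n) (ht : ∀ a < N, tgt a < n) {a : ℕ} (ha : a < N) (he : o k = N + a) :
    SweepInv X Y n r N src tgt (Done o (k + 1)) cnt F ans
      (if cnt (src a) = 1 ∧ cnt (tgt a) = 1 then 1 else bad)
      (if cnt (src a) = 1 ∧ cnt (tgt a) = 1 then key (o k) else last) := by
  have hcount := curCount_eq_count hkey ho hk (by omega) (by omega)
  have htie : key (o k) = tieTime X Y (src a) (tgt a) := by rw [he, (hkey a ha).2.1]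
  have hother : ∀ e, e ≠ N + a → (Done o (k + 1) e ↔ Done o k e) := by
    intro e hne
    rw [done_succ, he]
    simp [hne]
  have hself : Done o (k + 1) (N + a) := done_succ.2 (.inr he.symm)
  have hbad : (cnt (src a) = 1 ∧ cnt (tgt a) = 1) ↔ IsBad X Y r N src tgt a := by
    rw [h.cnt_eq _ (hs a ha), h.cnt_eq _ (ht a ha), hcount, hcount, htie, IsBad]
  refine ⟨fun v hv => ?_, h.F_eq, h.ans_le, ?_, ?_, ?_⟩
  · rw [curCount_done_succ (by omega) (by omega), h.cnt_eq v hv]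
  · rw [h.ans_iff]
    exact exists_congr fun b => and_congr_right fun hb => by rw [hother _ (by omega)]
  · split_ifs with h0
    · exact fun _ => ⟨a, ha, hself, hbad.1 h0, htie.symm⟩
    · intro hb
      obtain ⟨b, hb, hd, hl⟩ := h.exists_bad hb
      exact ⟨b, hb, done_succ.2 (.inl hd), hl⟩
  · intro b hb hd hbd
    rw [done_succ] at hd
    split_ifs with h0
    · refine ⟨rfl, ?_⟩
      rcases hd with hd | hd
      · rw [ho.done_iff' hk (by omega), (hkey b hb).2.1] at hd
        rcases hd with hd | hd
        · exact hd.le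
        · exact hd.1.le
      · obtain rfl : b = a := by omega
        exact htie.ge
    · rcases hd with hd | hd
      · exact h.of_bad b hb hd hbd
      · obtain rfl : b = a := by omega
        exact absurd (hbad.2 hbd) h0

-- Several edges can tie at the same time, and a bad one spoils that time for all. All marks of this
-- time precede the check, and `last` is the latest bad tie so far; hence a bad arc ties now iff the
-- flag is set and `last` is the present time.
open Classical in
theorem SweepInv.check (h : SweepInv X Y n r N src tgt (Done o k) cnt F ans bad last)
    (hkey : ∀ a < N, IsKey X Y r N src tgt key a) (ho : IsSorted key (4 * N) o) (hk : k < 4 * N)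
    {a : ℕ} (ha : a < N) (he : o k = 2 * N + a) :
    SweepInv X Y n r N src tgt (Done o (k + 1)) cnt F
      (if F = 0 ∧ ¬ (bad = 1 ∧ last = key (o k)) then 1 else ans) bad last := by
  have hcount := curCount_eq_count hkey ho hk (by omega) (by omega)
  have htie : key (o k) = tieTime X Y (src a) (tgt a) := by rw [he, (hkey a ha).2.2.1]
  have hother : ∀ e, e ≠ 2 * N + a → (Done o (k + 1) e ↔ Done o k e) := by
    intro e hne
    rw [done_succ, he]
    simp [hne]
  have hself : Done o (k + 1) (2 * N + a) := done_succ.2 (.inr he.symm)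
  have hF : F = 0 ↔ ∀ v < n, 0 < count X Y r N src tgt v (key (o k)) := by
    rw [h.F_eq, Finset.card_eq_zero, Finset.filter_eq_empty_iff]
    simp only [Finset.mem_range, ← hcount]
    refine forall_congr' fun v => forall_congr' fun hv => ?_
    rw [h.cnt_eq v hv]
    omega
  have hB : ¬ (bad = 1 ∧ last = key (o k)) ↔ ∀ b < N, tieTime X Y (src b) (tgt b) = key (o k) →
      ¬ (count X Y r N src tgt (src b) (key (o k)) = 1 ∧
        count X Y r N src tgt (tgt b) (key (o k)) = 1) := by
    rw [← not_iff_not, not_not]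
    push Not
    constructor
    · rintro ⟨hb, hl⟩
      obtain ⟨b, hb, -, hbd, hl'⟩ := h.exists_bad hb
      rw [IsBad, hl', hl] at hbd
      exact ⟨b, hb, hl'.trans hl, hbd⟩
    · rintro ⟨b, hb, hbt, hbd⟩
      have hbd' : IsBad X Y r N src tgt b := by rwa [IsBad, hbt]
      obtain ⟨h1, h2⟩ := h.of_bad b hb ((ho.done_iff' hk (by omega)).2
        (.inr ⟨(hkey b hb).2.1.trans hbt, by omega⟩)) hbd'
      refine ⟨h1, le_antisymm ?_ (hbt ▸ h2)⟩
      obtain ⟨b', hb', hd', -, hl'⟩ := h.exists_bad h1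
      rw [ho.done_iff' hk (by omega), (hkey b' hb').2.1, hl'] at hd'
      rcases hd' with hd' | hd'
      · exact hd'.le
      · exact hd'.1.le
  have hcheck : (F = 0 ∧ ¬ (bad = 1 ∧ last = key (o k))) ↔
      Check X Y n r N src tgt (tieTime X Y (src a) (tgt a)) := by
    rw [hF, hB, Check, htie]
  refine ⟨fun v hv => ?_, h.F_eq, ?_, ?_, ?_, ?_⟩
  · rw [curCount_done_succ (by omega) (by omega), h.cnt_eq v hv]
  · split_ifs
    · exact le_rfl
    · exact h.ans_le
  · split_ifs with h0
    · exact iff_of_true rfl ⟨a, ha, hself, hcheck.1 h0⟩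
    · rw [h.ans_iff]
      refine exists_congr fun b => and_congr_right fun hb => ?_
      rw [done_succ, or_and_right, he, or_iff_left]
      rintro ⟨hba, hc⟩
      obtain rfl : b = a := by omega
      exact h0 (hcheck.2 hc)
  · intro hb
    obtain ⟨b, hb, hd, hl⟩ := h.exists_bad hb
    exact ⟨b, hb, done_succ.2 (.inl hd), hl⟩
  · intro b hb hd
    exact h.of_bad b hb ((hother _ (by omega)).1 hd)

end

end RealRAM

/-! ### The sweep program -/

namespace RealRAM

/-- Decodes the current event. -/
def decode : Prog :=
  .seq (.setI 11 (.get 4 (.var 10)))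
  (.seq (.setI 12 (.div (.var 11) (.var 3)))
  (.seq (.setI 13 (.sub (.var 11) (.mul (.var 12) (.var 3))))
  (.seq (.setI 6 (.get 5 (.var 13))) (.setI 7 (.get 6 (.var 13))))))

/-- Processes the current event. -/
def process : Prog :=
  .ite (.ieq (.var 12) (.const 0))
    (.seq (.ite (.ieq (.get 7 (.var 7)) (.const 0)) (.setI 8 (.sub (.var 8) (.const 1))) .skip)
      (.storeI 7 (.var 7) (.add (.get 7 (.var 7)) (.const 1))))
  (.ite (.ieq (.var 12) (.const 1))
    (.ite (.and (.ieq (.get 7 (.var 6)) (.const 1)) (.ieq (.get 7 (.var 7)) (.const 1)))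
      (.seq (.setI 14 (.const 1)) (.setR 5 (.get 2 (.var 11)))) .skip)
  (.ite (.ieq (.var 12) (.const 2))
    (.ite (.and (.ieq (.var 8) (.const 0))
        (.not (.and (.ieq (.var 14) (.const 1)) (.req (.var 5) (.get 2 (.var 11))))))
      (.setI 9 (.const 1)) .skip)
    (.seq (.storeI 7 (.var 7) (.sub (.get 7 (.var 7)) (.const 1)))
      (.ite (.ieq (.get 7 (.var 7)) (.const 0)) (.setI 8 (.add (.var 8) (.const 1))) .skip))))

/-- Processes all events in their order. -/
def sweep : Prog :=
  .seq (.seq (.setI 9 (.const 0)) (.seq (.setI 14 (.const 0)) (.setI 10 (.const 0))))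
  (.loop (.ilt (.var 10) (.var 4))
    (.seq decode (.seq process (.setI 10 (.add (.var 10) (.const 1))))))

theorem runs_decode {W N p a : ℕ} {s : State} (hN : s.ivar 3 = N) (ha : a < N)
    (he : s.iarr 4 (s.ivar 10) = p * N + a) (hs : s.iarr 5 a ≤ W) (ht : s.iarr 6 a ≤ W)
    (hW : p * N + a ≤ W) : Runs W decode s 50 fun s' => (s'.ivar 11 = p * N + a ∧
      s'.ivar 12 = p ∧ s'.ivar 6 = s.iarr 5 a ∧ s'.ivar 7 = s.iarr 6 a) ∧ Frame decode s s' := by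
  have h1 : (p * N + a) / N = p := by
    rw [mul_comm, Nat.mul_add_div (by omega), Nat.div_eq_of_lt ha, add_zero]
  have h2 : p ≤ p * N := Nat.le_mul_of_pos_right p (by omega)
  refine Runs.frame (Runs.mono (Prog.wp.runs ?_) (by simp [decode]) fun _ h => h)
  simp [decode, hN, he, h1, hs, ht]
  omega

/-- Before the first event `curCount` is `initCount`, and after the last one every event is done, so
`ans_iff` becomes the criterion. The arbitrary initial value of `last` is harmless because the flag
starts at 0. -/
theorem runs_sweep {W : ℕ} {s : State} {n N r : ℕ} {src tgt o : ℕ → ℕ} {X Y key : ℕ → ℝ}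
    (hN : s.ivar 3 = N) (hM : s.ivar 4 = 4 * N) (hW : 2 * n + 4 * N + 8 ≤ W)
    (hsrc : s.iarr 5 = src) (htgt : s.iarr 6 = tgt) (ho : s.iarr 4 = o) (hK : s.rarr 2 = key)
    (hs : ∀ a < N, src a < n) (ht : ∀ a < N, tgt a < n)
    (hkey : ∀ a < N, IsKey X Y r N src tgt key a) (hsort : IsSorted key (4 * N) o)
    (hc : ∀ v < n, s.iarr 7 v = initCount Y r N src tgt v)
    (hF : s.ivar 8 = ((Finset.range n).filter fun v => s.iarr 7 v = 0).card) :
    Runs W sweep s (1000 * (N + 1)) fun s' => s'.ivar 9 ≤ 1 ∧ (s'.ivar 9 = 1 ↔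
      ∃ a < N, Check X Y n r N src tgt (tieTime X Y (src a) (tgt a))) := by
  classical
  refine Runs.mono (Runs.for_loop (N := 4 * N) (c := 200) (fun k s' => (s'.ivar 10 = k ∧
    s'.ivar 3 = N ∧ s'.ivar 4 = 4 * N ∧ s'.iarr 5 = src ∧ s'.iarr 6 = tgt ∧ s'.iarr 4 = o ∧
    s'.rarr 2 = key) ∧ SweepInv X Y n r N src tgt (Done o k) (s'.iarr 7) (s'.ivar 8) (s'.ivar 9)
      (s'.ivar 14) (s'.rvar 5)) ?_ ?_ ?_) ?_ ?_
  · simp [hN, hM, hsrc, htgt, ho, hK]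
    refine ⟨fun v hv => ?_, hF, by omega, ?_, ?_, ?_⟩
    · rw [hc v hv, initCount, curCount]
      simp [curWeight, Done]
    · simp [Done]
    · simp
    · simp [Done]
  · rintro k s' - ⟨⟨h5, h1, h4, -⟩, -⟩
    simp [h5, h4]
  · rintro k s' hk ⟨⟨h10, h3, h4, ha5, ha6, ha4, hr2⟩, hI⟩
    obtain ⟨p, a, hp, ha, he⟩ : ∃ p a, p < 4 ∧ a < N ∧ o k = p * N + a := by
      have hlt := hsort.lt k hk
      have hpos : 0 < N := by omega
      exact ⟨o k / N, o k % N, (Nat.div_lt_iff_lt_mul hpos).2 hlt, Nat.mod_lt _ hpos,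
        (Nat.div_add_mod' _ _).symm⟩
    have hbound : p * N + a ≤ 4 * N := he ▸ (hsort.lt k hk).le
    have hsa := hs a ha
    have hta := ht a ha
    refine Runs.mono (Runs.seq (T' := 150) (runs_decode (p := p) (a := a) h3 ha
      (by rw [ha4, h10, he]) (by rw [ha5]; omega) (by rw [ha6]; omega) (by omega)) fun s1 h1 =>
      (Prog.wp.runs ?_).mono (by simp [process]) fun _ h => h) (by simp) fun _ h => h
    obtain ⟨⟨g11, g12, g6, g7⟩, fr⟩ := h1
    have f := fun x hx => fr.ivar x (by simpa [decode, Prog.WritesI] using hx)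
    have f3 := f 3 (by simp)
    have f4 := f 4 (by simp)
    have f8 := f 8 (by simp)
    have f9 := f 9 (by simp)
    have f10 := f 10 (by simp)
    have f14 := f 14 (by simp)
    have fv := fr.rvar 5 (by simp [decode, Prog.WritesR])
    have fi := fun x => fr.iarr x (by simp [decode, Prog.StoresI])
    have fr := fun x => fr.rarr x (by simp [decode, Prog.StoresR])
    rw [ha5] at g6
    rw [ha6] at g7
    have hcv : s'.iarr 7 (tgt a) ≤ 1 + 2 * N := (hI.cnt_eq _ hta).trans_le curCount_le
    have hFle : s'.ivar 8 ≤ n := by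
      rw [hI.F_eq]
      simpa using Finset.card_filter_le (Finset.range n) fun v => s'.iarr 7 v = 0
    have hkW : k + 1 ≤ W := by omega
    obtain rfl | rfl | rfl | rfl : p = 0 ∨ p = 1 ∨ p = 2 ∨ p = 3 := by omega
    · have hI' := hI.activate hkey hsort hk ht ha (by omega)
      simp [process, g11, g12, g6, g7, f3, f4, f8, f9, f10, f14, fv, fi, fr, h10, h3, h4, ha5, ha6,
        ha4, hr2]
      refine ⟨fun h0 => ⟨by omega, by omega, hkW, ?_⟩, fun h0 => ⟨by omega, hkW, ?_⟩⟩
      · simpa [h0] using hI'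
      · simpa [h0] using hI'
    · have hI' := hI.mark hkey hsort hk hs ht ha (by omega)
      rw [he] at hI'
      simp [process, g11, g12, g6, g7, f3, f4, f8, f9, f10, f14, fv, fi, fr, h10, h3, h4, ha5, ha6,
        ha4, hr2]
      refine ⟨fun h0 h1 => ⟨by omega, hkW, ?_⟩, fun h0 => ⟨hkW, ?_⟩⟩
      · simpa [h0, h1] using hI'
      · rwa [if_neg (by tauto), if_neg (by tauto)] at hI'
    · have hI' := hI.check hkey hsort hk ha (by omega)
      rw [he] at hI'
      simp [process, g11, g12, g6, g7, f3, f4, f8, f9, f10, f14, fv, fi, fr, h10, h3, h4, ha5, ha6,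
        ha4, hr2]
      refine ⟨fun h0 h1 => ⟨by omega, hkW, ?_⟩, fun h0 => ⟨hkW, ?_⟩⟩
      · rwa [if_pos (by tauto)] at hI'
      · rwa [if_neg (by tauto)] at hI'
    · have hI' := hI.deactivate hkey hsort hk ht ha (by omega)
      simp [process, g11, g12, g6, g7, f3, f4, f8, f9, f10, f14, fv, fi, fr, h10, h3, h4, ha5, ha6,
        ha4, hr2]
      refine ⟨by omega, fun h0 => ⟨by omega, hkW, ?_⟩, fun h0 => ⟨hkW, ?_⟩⟩
      · rwa [if_pos h0] at hI'
      · rwa [if_neg (by omega)] at hI'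
  · simp
    omega
  · rintro s' ⟨-, h⟩
    refine ⟨h.ans_le, h.ans_iff.trans (exists_congr fun a => and_congr_right fun ha =>
      and_iff_right ?_)⟩
    exact hsort.exists_eq (by omega)

end RealRAM

namespace RealRAM

/-! ### The program -/

theorem Coords.of_shear {G : RootedGeometricGraph} {n N r : ℕ} {src tgt : ℕ → ℕ}
    {pv : ℕ → G.verts} (hL : Lists G n N r src tgt pv) {x y Y : ℕ → ℝ} {δ : ℝ} (hδ : 0 < δ)
    (hx : ∀ i < n, x i = (pv i : Plane) 0) (hy : ∀ i < n, y i = (pv i : Plane) 1)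
    (hY : ∀ i < n, Y i = y i + δ * x i)
    (h : ∀ a < N, ((y (tgt a) - y (src a)) / (x (tgt a) - x (src a)) < 0 →
        2 * δ ≤ - ((y (tgt a) - y (src a)) / (x (tgt a) - x (src a)))) ∧
      ((y (src a) - y r) / (x (src a) - x r) < 0 →
        2 * δ ≤ - ((y (src a) - y r) / (x (src a) - x r)))) :
    Coords G n N r src tgt pv δ x Y := by
  have hne : ∀ i < n, ∀ j < n, i ≠ j → x i - x j ≠ 0 ∨ y i - y j ≠ 0 := by
    intro i hi j hj hij
    by_contra! hc
    refine hij (hL.inj i hi j hj (Subtype.coe_injective ?_))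
    ext l
    fin_cases l
    · have := hc.1
      rw [hx i hi, hx j hj] at this
      exact sub_eq_zero.1 this
    · have := hc.2
      rw [hy i hi, hy j hj] at this
      exact sub_eq_zero.1 this
  refine ⟨hx, fun i hi => by rw [hY i hi, hx i hi, hy i hi], fun a ha h' => ?_,
    fun a ha har h' => ?_⟩
  · have hs := hL.src_lt a ha
    have ht := hL.tgt_lt a ha
    refine shear_ne_zero (hne _ ht _ hs (hL.src_ne_tgt ha).symm) hδ (h a ha).1 ?_
    rw [hY _ ht, hY _ hs] at h'
    linarith
  · have hs := hL.src_lt a ha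
    refine shear_ne_zero (hne _ hs _ hL.root_lt har) hδ (h a ha).2 ?_
    rw [hY _ hL.root_lt, hY _ hs] at h'
    linarith

/-- Arcs are distinct ordered pairs of vertices. This bounds the words and makes the logarithm of
the number of events `O(log n)`. -/
theorem Lists.card_le {G : RootedGeometricGraph} {n N r : ℕ} {src tgt : ℕ → ℕ}
    {pv : ℕ → G.verts} (hL : Lists G n N r src tgt pv) : N ≤ n * n := by
  have h := Finset.card_le_card_of_injOn (s := Finset.range N)
    (t := Finset.range n ×ˢ Finset.range n) (fun a => (src a, tgt a))
    (fun a ha => by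
      have ha := Finset.mem_range.1 ha
      simpa using ⟨hL.src_lt a ha, hL.tgt_lt a ha⟩)
    (fun a ha b hb hab => by
      simp only [Finset.coe_range, Set.mem_Iio] at ha hb
      exact hL.arc_inj a ha b hb (congrArg Prod.fst hab) (congrArg Prod.snd hab))
  simpa using h

theorem lists_of_edges {G : RootedGeometricGraph} {n m r : ℕ} {src tgt e0 e1 : ℕ → ℕ}
    {pv : ℕ → G.verts} (inj : ∀ i < n, ∀ j < n, pv i = pv j → i = j)
    (surj : ∀ v, ∃ i < n, pv i = v) (hr : r < n) (root : pv r = G.root)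
    (ed : Fin m ≃ G.graph.edgeSet) (he0 : ∀ j < m, e0 j < n) (he1 : ∀ j < m, e1 j < n)
    (hed : ∀ j : Fin m, s(pv (e0 j), pv (e1 j)) = (ed j : Sym2 G.verts))
    (h : ∀ j < m, src j = e0 j ∧ tgt j = e1 j ∧ src (m + j) = e1 j ∧ tgt (m + j) = e0 j) :
    Lists G n (2 * m) r src tgt pv := by
  have cases : ∀ a < 2 * m, ∃ j < m, a = j ∧ src a = e0 j ∧ tgt a = e1 j ∨
      a = m + j ∧ src a = e1 j ∧ tgt a = e0 j := by
    intro a ha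
    by_cases ham : a < m
    · exact ⟨a, ham, .inl ⟨rfl, (h a ham).1, (h a ham).2.1⟩⟩
    · obtain ⟨j, rfl⟩ := Nat.exists_eq_add_of_le (not_lt.1 ham)
      have hj : j < m := by omega
      exact ⟨j, hj, .inr ⟨rfl, (h j hj).2.2⟩⟩
  have hadj : ∀ j < m, G.graph.Adj (pv (e0 j)) (pv (e1 j)) := fun j hj => by
    rw [← SimpleGraph.mem_edgeSet, hed ⟨j, hj⟩]
    exact (ed ⟨j, hj⟩).2
  have hinj : ∀ i < m, ∀ j < m, s(pv (e0 i), pv (e1 i)) = s(pv (e0 j), pv (e1 j)) → i = j := by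
    intro i hi j hj hij
    have := (hed ⟨i, hi⟩).symm.trans (hij.trans (hed ⟨j, hj⟩))
    exact congrArg Fin.val (ed.injective (Subtype.coe_injective this))
  refine ⟨inj, surj, hr, root, fun a ha => ?_, fun a ha => ?_, fun a ha => ?_,
    fun u hu v hv huv => ?_, fun a ha b hb hs ht => ?_⟩
  · obtain ⟨j, hj, ⟨-, h1, -⟩ | ⟨-, h1, -⟩⟩ := cases a ha
    · exact h1 ▸ he0 j hj
    · exact h1 ▸ he1 j hj
  · obtain ⟨j, hj, ⟨-, -, h1⟩ | ⟨-, -, h1⟩⟩ := cases a ha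
    · exact h1 ▸ he1 j hj
    · exact h1 ▸ he0 j hj
  · obtain ⟨j, hj, ⟨-, h1, h2⟩ | ⟨-, h1, h2⟩⟩ := cases a ha
    · rw [h1, h2]
      exact hadj j hj
    · rw [h1, h2]
      exact (hadj j hj).symm
  · obtain ⟨j, hj⟩ := ed.surjective ⟨s(pv u, pv v), huv⟩
    have h1 := hed j
    rw [hj, Sym2.eq_iff] at h1
    have h2 := h j j.2
    rcases h1 with ⟨h3, h4⟩ | ⟨h3, h4⟩
    · refine ⟨j, by omega, ?_, ?_⟩
      · rw [h2.1, inj _ (he0 j j.2) _ hu h3]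
      · rw [h2.2.1, inj _ (he1 j j.2) _ hv h4]
    · refine ⟨m + j, by omega, ?_, ?_⟩
      · rw [h2.2.2.1, inj _ (he1 j j.2) _ hu h4]
      · rw [h2.2.2.2, inj _ (he0 j j.2) _ hv h3]
  · obtain ⟨i, hi, ⟨hai, h1, h2⟩ | ⟨hai, h1, h2⟩⟩ := cases a ha <;>
    obtain ⟨j, hj, ⟨hbj, h3, h4⟩ | ⟨hbj, h3, h4⟩⟩ := cases b hb <;>
    rw [h1, h3] at hs <;> rw [h2, h4] at ht
    · rw [hai, hbj, hinj i hi j hj (by rw [hs, ht])]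
    -- Equal arcs from different halves would come from the same edge, whose two ends would then
    -- coincide.
    · obtain rfl := hinj i hi j hj (by rw [hs, ht, Sym2.eq_swap])
      exact absurd (congrArg pv hs) (hadj i hi).ne
    · obtain rfl := hinj i hi j hj (by rw [hs, ht, Sym2.eq_swap])
      exact absurd (congrArg pv ht) (hadj i hi).ne
    · rw [hai, hbj, hinj i hi j hj (by rw [hs, ht])]

/-- Decides whether a graph with at least one edge is rooted uniform monotone. -/
def decideWithEdges : Prog :=
  .seq listArcs (.seq findShear (.seq shear (.seq clearCounts (.seq computeKeys
    (.seq countUnsupported (.seq sort (.seq sweep (.setI 0 (.var 9)))))))))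

theorem runs_decideWithEdges {G : RootedGeometricGraph} (hG : G.InGeneralPosition) {s : State}
    {n m : ℕ} (pt : Fin n ≃ G.verts) (ed : Fin m ≃ G.graph.edgeSet) (hn : s.ivar 0 = n)
    (hm1 : s.ivar 1 = m) (hr : s.ivar 2 = (pt.symm G.root : ℕ))
    (hpt : ∀ i : Fin n, s.rarr 0 i = (pt i : Plane) 0 ∧ s.rarr 1 i = (pt i : Plane) 1)
    (hed : ∀ j : Fin m, ∃ u v : Fin n,
      s.iarr 0 j = u ∧ s.iarr 1 j = v ∧ s(pt u, pt v) = (ed j : Sym2 G.verts))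
    (hm : 0 < m) {W f : ℕ} (hW : ∀ N ≤ n * n, 2 * n + 16 * N + 8 ≤ W)
    (hf : 4 * (n * n) ≤ 2 ^ f) :
    Runs W decideWithEdges s (4000 * (m + n + 1) + 800 * (8 * m + 1) * (f + 1))
      fun s' => s'.ivar 0 ≤ 1 ∧ (s'.ivar 0 = 1 ↔ G.RootedUniformMonotone) := by
  set r : ℕ := (pt.symm G.root).val
  have hrn : r < n := (pt.symm G.root).2
  set pv : ℕ → G.verts := fun i => if h : i < n then pt ⟨i, h⟩ else G.root with hpv
  have hpv' : ∀ i : Fin n, pv i = pt i := fun i => by simp [hpv]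
  have he01 : ∀ j < m, s.iarr 0 j < n ∧ s.iarr 1 j < n := by
    intro j hj
    obtain ⟨u, v, hu, hv, -⟩ := hed ⟨j, hj⟩
    simp only at hu hv
    rw [hu, hv]
    exact ⟨u.2, v.2⟩
  have hedge : ∀ j : Fin m, s(pv (s.iarr 0 j), pv (s.iarr 1 j)) = (ed j : Sym2 G.verts) := by
    intro j
    obtain ⟨u, v, hu, hv, huv⟩ := hed j
    rw [hu, hv, hpv', hpv', huv]
  have hlist := fun src tgt => lists_of_edges (G := G) (n := n) (m := m) (r := r) (src := src)
    (tgt := tgt) (e0 := s.iarr 0) (e1 := s.iarr 1) (pv := pv)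
    (fun i hi j hj hij => by
      rw [hpv' ⟨i, hi⟩, hpv' ⟨j, hj⟩] at hij
      exact congrArg Fin.val (pt.injective hij))
    (fun v => ⟨pt.symm v, (pt.symm v).2, by rw [hpv', Equiv.apply_symm_apply]⟩) hrn
    (by rw [hpv', Equiv.apply_symm_apply]) ed (fun j hj => (he01 j hj).1)
    (fun j hj => (he01 j hj).2) hedge
  -- The bound on the words is needed before the program has listed its arcs, so an explicit listing
  -- is used here.
  have hNn : 2 * m ≤ n * n :=
    (hlist (fun a => if a < m then s.iarr 0 a else s.iarr 1 (a - m))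
      (fun a => if a < m then s.iarr 1 a else s.iarr 0 (a - m))
      fun j hj => by simp [hj]).card_le
  have hW1 : 2 * n + 32 * m + 8 ≤ W := by
    have := hW (2 * m) hNn
    omega
  refine Runs.mono (T := 200 * (m + 1) + (200 * (2 * m + 1) + (200 * (n + 1) + (200 * (n + 1) +
    (400 * (2 * m + 1) + (200 * (n + 1) + (800 * (8 * m + 1) * (f + 1) +
      (1000 * (2 * m + 1) + 2)))))))) ?_ ?_ fun _ h => h
  swap
  -- The nonlinear sorting cost is abstracted to `z` so that the rest is linear.
  · have key : ∀ z : ℕ, 200 * (m + 1) + (200 * (2 * m + 1) + (200 * (n + 1) + (200 * (n + 1) +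
        (400 * (2 * m + 1) + (200 * (n + 1) + (z + (1000 * (2 * m + 1) + 2))))))) ≤
        4000 * (m + n + 1) + z := fun z => by omega
    exact key _
  refine Runs.seq (runs_listArcs (n := n) hm1 (by omega) he01).frame fun s1 h1 => ?_
  obtain ⟨⟨hN, hM, harcs⟩, fr1⟩ := h1
  have i0 : s1.ivar 0 = n := (fr1.ivar 0 (by simp [listArcs, Prog.WritesI])).trans hn
  have i2 : s1.ivar 2 = r := (fr1.ivar 2 (by simp [listArcs, Prog.WritesI])).trans hr
  have hx1 : s1.rarr 0 = s.rarr 0 := fr1.rarr 0 (by simp [listArcs, Prog.StoresR])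
  have hy1 : s1.rarr 1 = s.rarr 1 := fr1.rarr 1 (by simp [listArcs, Prog.StoresR])
  have hL := hlist _ _ harcs
  refine Runs.seq (runs_findShear hN i2 (by omega) rfl rfl hx1 hy1).frame fun s2 h2 => ?_
  obtain ⟨⟨hδ, hslopes⟩, fr2⟩ := h2
  have w2 : ∀ x, x ≠ 5 → s2.ivar x = s1.ivar x := fun x hx =>
    fr2.ivar x (by simpa [findShear, lower, Prog.WritesI] using hx)
  have a2 : ∀ x, s2.iarr x = s1.iarr x := fun x =>
    fr2.iarr x (by simp [findShear, lower, Prog.StoresI])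
  have r2 : ∀ x, s2.rarr x = s1.rarr x := fun x =>
    fr2.rarr x (by simp [findShear, lower, Prog.StoresR])
  refine Runs.seq (runs_shear (n := n) ((w2 0 (by simp)).trans i0) (by omega)).frame
    fun s3 h3 => ?_
  obtain ⟨hY, fr3⟩ := h3
  have w3 : ∀ x, x ≠ 5 → s3.ivar x = s1.ivar x := fun x hx =>
    (fr3.ivar x (by simpa [shear, Prog.WritesI] using hx)).trans (w2 x hx)
  have a3 : ∀ x, s3.iarr x = s1.iarr x := fun x =>
    (fr3.iarr x (by simp [shear, Prog.StoresI])).trans (a2 x)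
  have hx3 : s3.rarr 0 = s.rarr 0 :=
    (fr3.rarr 0 (by simp [shear, Prog.StoresR])).trans ((r2 0).trans hx1)
  rw [r2, r2, hx1, hy1] at hY
  have hC : Coords G n (2 * m) r (s1.iarr 5) (s1.iarr 6) pv (s2.rvar 0) (s.rarr 0) (s3.rarr 1) := by
    refine Coords.of_shear hL hδ (fun i hi => ?_) (fun i hi => ?_) hY hslopes
    · rw [hpv' ⟨i, hi⟩]
      exact (hpt ⟨i, hi⟩).1
    · rw [hpv' ⟨i, hi⟩]
      exact (hpt ⟨i, hi⟩).2
  have hspec := hC.rootedUniformMonotone_iff hL hG (by omega)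
  refine Runs.seq (runs_clearCounts (n := n) (r := r) ((w3 0 (by simp)).trans i0)
    ((w3 2 (by simp)).trans i2) hrn (by omega)).frame fun s4 h4 => ?_
  obtain ⟨hcnt0, fr4⟩ := h4
  have w4 : ∀ x, x ≠ 5 → s4.ivar x = s1.ivar x := fun x hx =>
    (fr4.ivar x (by simpa [clearCounts, Prog.WritesI] using hx)).trans (w3 x hx)
  have a4 : ∀ x, x ≠ 7 → s4.iarr x = s1.iarr x := fun x hx =>
    (fr4.iarr x (by simpa [clearCounts, Prog.StoresI] using hx)).trans (a3 x)
  have r4 : ∀ x, s4.rarr x = s3.rarr x := fun x =>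
    fr4.rarr x (by simp [clearCounts, Prog.StoresR])
  refine Runs.seq (runs_computeKeys (n := n) ((w4 3 (by simp)).trans hN)
    ((w4 2 (by simp)).trans i2) (by omega) (a4 5 (by simp)) (a4 6 (by simp))
    ((r4 0).trans hx3) (r4 1) hL.src_lt hL.tgt_lt hcnt0).frame fun s5 h5 => ?_
  obtain ⟨⟨hkey, hcnt⟩, fr5⟩ := h5
  have w5 : ∀ x, x ≠ 5 ∧ x ≠ 6 ∧ x ≠ 7 ∧ x ≠ 13 → s5.ivar x = s1.ivar x := fun x hx =>
    (fr5.ivar x (by simp [computeKeys, arcTimes, Prog.WritesI]; omega)).trans (w4 x hx.1)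
  have a5 : ∀ x, x ≠ 7 → s5.iarr x = s1.iarr x := fun x hx =>
    (fr5.iarr x (by simpa [computeKeys, arcTimes, Prog.StoresI] using hx)).trans (a4 x hx)
  refine Runs.seq (runs_countUnsupported (n := n) ((w5 0 (by simp)).trans i0) (by omega)).frame
    fun s6 h6 => ?_
  obtain ⟨hF, fr6⟩ := h6
  have w6 : ∀ x, x ≠ 5 ∧ x ≠ 6 ∧ x ≠ 7 ∧ x ≠ 13 ∧ x ≠ 8 → s6.ivar x = s1.ivar x := fun x hx =>
    (fr6.ivar x (by simp [countUnsupported, Prog.WritesI]; omega)).trans (w5 x (by omega))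
  have a6 : ∀ x, s6.iarr x = s5.iarr x := fun x =>
    fr6.iarr x (by simp [countUnsupported, Prog.StoresI])
  have r6 : s6.rarr 2 = s5.rarr 2 := fr6.rarr 2 (by simp [countUnsupported, Prog.StoresR])
  refine Runs.seq (runs_sort (f := f) ((w6 4 (by simp)).trans hM) r6 (by omega)
    (by omega)).frame fun s7 h7 => ?_
  obtain ⟨hsort, fr7⟩ := h7
  have w7 : ∀ x, x = 3 ∨ x = 4 ∨ x = 8 → s7.ivar x = s6.ivar x := fun x hx =>
    fr7.ivar x (by
      simp [sort, buildTree, extractAll, updatePath, updateNode, Prog.WritesI]; omega)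
  have a7 : ∀ x, x ≠ 2 ∧ x ≠ 4 → s7.iarr x = s5.iarr x := fun x hx =>
    (fr7.iarr x (by
      simp [sort, buildTree, extractAll, updatePath, updateNode, Prog.StoresI]; omega)).trans (a6 x)
  have r7 : s7.rarr 2 = s5.rarr 2 := (fr7.rarr 2 (by
    simp [sort, buildTree, extractAll, updatePath, updateNode, Prog.StoresR])).trans r6
  rw [show 8 * m = 4 * (2 * m) by ring] at hsort
  refine Runs.seq (runs_sweep (n := n) (N := 2 * m) (r := r)
    ((w7 3 (by simp)).trans ((w6 3 (by simp)).trans hN)) ?_ (by omega)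
    ((a7 5 (by simp)).trans (a5 5 (by simp))) ((a7 6 (by simp)).trans (a5 6 (by simp))) rfl r7
    hL.src_lt hL.tgt_lt hkey hsort ?_ ?_) fun s8 h8 => (Prog.wp.runs ?_).mono (by simp) fun _ h => h
  · rw [w7 4 (by simp), w6 4 (by simp), hM]
    ring
  · intro v hv
    rw [a7 7 (by simp), hcnt v hv]
  · rw [w7 8 (by simp), hF, a7 7 (by simp)]
  · simp [h8.1, h8.2, hspec]
    omega

/-- A connected graph without edges consists of the root alone, and the trivial path does. -/
theorem rootedUniformMonotone_of_numEdges_eq_zero {G : RootedGeometricGraph}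
    (hconn : G.graph.Connected) (hm : G.numEdges = 0) : G.RootedUniformMonotone := by
  have h := hconn.card_vert_le_card_edgeSet_add_one
  rw [Nat.card_coe_set_eq, show G.graph.edgeSet.ncard = 0 from hm] at h
  have := Finite.card_le_one_iff_subsingleton.1 h
  refine ⟨_, sweepDir_ne_zero (δ := 0) (t := 0), fun p => ?_⟩
  obtain rfl := Subsingleton.elim G.root p
  exact ⟨.nil, .nil, .inl (by simp [RootedGeometricGraph.coordsAlong_eq_map])⟩

/-- Sorting costs at most `50400 * (m * L)`, and the linear phases at most `16000 * m` because `n ≤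
m + 1`; both are absorbed as `1 ≤ L`. Finally `L ≤ 2 * Real.log n` since `Real.log 2` exceeds one
half. The extra 3 pays for the initial test whether there are edges. -/
theorem time_bound {n m T : ℕ} (hm : 0 < m) (hn : 2 ≤ n) (hnm : n ≤ m + 1)
    (hT : T ≤ 4000 * (m + n + 1) + 800 * (8 * m + 1) * (4 + 2 * Nat.log 2 n + 1)) :
    (T : ℝ) + 3 ≤ 200000 * max 1 ((m : ℝ) * Real.log n) := by
  have hlog : 1 ≤ Nat.log 2 n := Nat.log_pos one_lt_two hn
  set L := Nat.log 2 n
  have h1 : T + 3 ≤ 100000 * (m * L) := by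
    have : m ≤ m * L := Nat.le_mul_of_pos_right m hlog
    have h2 : 800 * (8 * m + 1) * (4 + 2 * L + 1) ≤ 800 * (9 * m) * (7 * L) := by
      gcongr <;> omega
    have h3 : 800 * (9 * m) * (7 * L) = 50400 * (m * L) := by ring
    generalize m * L = z at *
    omega
  have h2 : (L : ℝ) * Real.log 2 ≤ Real.log n := by
    rw [← Real.log_pow]
    refine Real.log_le_log (by positivity) ?_
    exact_mod_cast Nat.pow_log_le_self 2 (by omega)
  have h3 : (L : ℝ) ≤ 2 * Real.log n := by
    nlinarith [Real.log_two_gt_d9, (Nat.cast_nonneg L : (0 : ℝ) ≤ L)]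
  have h4 : ((T + 3 : ℕ) : ℝ) ≤ ((100000 * (m * L) : ℕ) : ℝ) := Nat.cast_le.2 h1
  push_cast at h4
  have h5 : (m : ℝ) * L ≤ m * (2 * Real.log n) := by gcongr
  have h6 := le_max_right 1 ((m : ℝ) * Real.log n)
  nlinarith

end RealRAM

/-- Some program, run with words of `O(log |P|)` bits, decides (answer `1` or `0` in word variable
`0`) in `O(|E| log |P|)` steps whether a given rooted connected geometric graph in general position
is rooted uniform monotone. For `|P| ≥ 2` the number `|E| log |P|` is at least `log 2`, so the
maximum with `1` matters only for one-point graphs. -/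
theorem mainTheorem7 :
    ∃ (prog : RealRAM.Prog) (C : ℝ) (k : ℕ),
      ∀ G : RootedGeometricGraph, G.InGeneralPosition → G.graph.Connected →
        ∀ s : RealRAM.State, RealRAM.Encodes s G →
          ∃ (t : ℕ) (s' : RealRAM.State),
            RealRAM.Exec ((G.numVerts + 1) ^ k) prog s t s' ∧
            (t : ℝ) ≤ C * max 1 ((G.numEdges : ℝ) * Real.log (G.numVerts : ℝ)) ∧
            (G.RootedUniformMonotone → s'.ivar 0 = 1) ∧
            (¬ G.RootedUniformMonotone → s'.ivar 0 = 0) := by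
  refine ⟨.ite (.ieq (.var 1) (.const 0)) (.setI 0 (.const 1)) RealRAM.decideWithEdges, 200000, 10,
    fun G hG hconn s hs => ?_⟩
  have hm1 : s.ivar 1 = G.numEdges := by
    obtain ⟨_, _, _, h, _⟩ := hs
    exact h
  obtain ⟨pt, ed, hn0, -, hr, hpt, hed⟩ := hs
  rcases Nat.eq_zero_or_pos G.numEdges with hm | hm
  · refine ⟨_, _, RealRAM.Exec.iteTrue (by simp [hm1, hm]) (RealRAM.Exec.setI _ _ _ ?_), ?_, ?_, ?_⟩
    · exact Nat.one_le_pow _ _ (Nat.succ_pos _)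
    · have := le_max_left 1 ((G.numEdges : ℝ) * Real.log (G.numVerts : ℝ))
      norm_num
      linarith
    · simp
    · exact fun h => absurd (RealRAM.rootedUniformMonotone_of_numEdges_eq_zero hconn hm) h
  · have hnm : G.numVerts ≤ G.numEdges + 1 := by
      simpa [RootedGeometricGraph.numVerts, RootedGeometricGraph.numEdges, Nat.card_coe_set_eq]
        using hconn.card_vert_le_card_edgeSet_add_one
    have hn : 2 ≤ G.numVerts := by
      obtain ⟨e, he⟩ := Set.nonempty_of_ncard_ne_zero hm.ne'
      induction e using Sym2.ind with
      | _ u v =>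
        exact Finset.one_lt_card.2 ⟨u, u.2, v, v.2, Subtype.coe_injective.ne
          ((SimpleGraph.mem_edgeSet _).1 he).ne⟩
    have hW : ∀ N ≤ G.numVerts * G.numVerts,
        2 * G.numVerts + 16 * N + 8 ≤ (G.numVerts + 1) ^ 10 := by
      intro N hN
      have h1 : (G.numVerts + 1) ^ 10 = (G.numVerts + 1) ^ 8 * (G.numVerts + 1) ^ 2 := by ring
      -- Since `2 ≤ n`, eight of the ten factors absorb the constants, and the remaining square
      -- dominates `N ≤ n * n`.
      have h2 : 3 ^ 8 ≤ (G.numVerts + 1) ^ 8 := Nat.pow_le_pow_left (by omega) 8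
      rw [h1]
      refine le_trans ?_ (Nat.mul_le_mul_right _ h2)
      nlinarith
    -- This exponent bounds the depth of the tournament tree: there are four events per arc, at most
    -- `n * n` arcs, and `n < 2 ^ (Nat.log 2 n + 1)`.
    have hf : 4 * (G.numVerts * G.numVerts) ≤ 2 ^ (4 + 2 * Nat.log 2 G.numVerts) := by
      have h1 := Nat.lt_pow_succ_log_self one_lt_two G.numVerts
      calc 4 * (G.numVerts * G.numVerts)
          ≤ 4 * (2 ^ (Nat.log 2 G.numVerts + 1) * 2 ^ (Nat.log 2 G.numVerts + 1)) := by gcongr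
        _ = 2 ^ (4 + 2 * Nat.log 2 G.numVerts) := by ring
    obtain ⟨t, s', hexec, ht, hle, hiff⟩ :=
      RealRAM.runs_decideWithEdges hG pt ed hn0 hm1 hr hpt hed hm hW hf
    refine ⟨_, s', RealRAM.Exec.iteFalse (by simp [hm1]; omega) hexec, ?_, hiff.2, fun h => ?_⟩
    · have := RealRAM.time_bound hm hn hnm ht
      push_cast [RealRAM.BExp.cost, RealRAM.IExp.cost]
      linarith
    · have := hiff.not.2 h
      omega
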